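/- Let $\mathbb T=\mathbb R/2\pi\mathbb Z$, let $V\colon\mathbb T\to\mathbb R$ be smooth, and let $\alpha\in(0,\infty)$, $\tau\in\mathbb R$. For smooth $U\colon\mathbb T\to\mathbb R$ put $Z[U]=\int_{\mathbb T}e^{-V-U}$, $Z=Z[0]$, $\mu_U=e^{-V-U}/Z[U]$, $\mu=\mu_0$ and $\mathcal L_U=e^{V+U}\frac{d}{dx}\bigl(e^{-V-U}\frac{d}{dx}\,\cdot\,\bigr)$. For an observable $f$ with $I=\mu(f)$, let $\phi_{f,U}\in H^1(\mu_U)$, with $\int\phi_{f,U}\,d\mu_U=0$, be the weak solution of the Poisson equation $-\mathcal L_U\phi=(f-I)e^{U}$, and let $$\sigma^2_f[U]=\frac{2Z[U]^2}{Z^2}\int_{\mathbb T}|\phi_{f,U}'|^2\,d\mu_U$$ be the asymptotic variance. Let $J\ge 2$ be even, and let $(f_j,\lambda_j)_{1\le j\le J}$ be the first $J$ eigenfunctions and eigenvalues of $\mathcal K=e^{V}(-\Delta+\tau^2)^{-\alpha}e^{-V}$, regarded as an operator on the space $\{f\in L^2(e^{-2V}):\int_{\mathbb T}fe^{-V}=0\}$.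 That is, the eigenvalues are listed in nonincreasing order with multiplicity, the eigenfunctions are orthogonal in $L^2(e^{-2V})$ and all have the same norm in that space, and no eigenfunction orthogonal to $f_1,\dots,f_J$ has an eigenvalue larger than $\lambda_J$. Let $\sigma^2[U]=\mathbb E\bigl[\sigma^2_f[U]\bigr]$, where $f=\sum_{j=1}^J\sqrt{\lambda_j}\,u_jf_j$ with independent $u_j\sim\mathcal N(0,1)$. Then: 1. For every smooth $U$ and every $u\in\mathbb R^J$, the Poisson equation for $f=\sum_{j}\sqrt{\lambda_j}u_jf_j$ has a solution, unique up to almost everywhere equality, and $\sigma^2_f[U]$ is integrable with respect to the law of $u$, so that $\sigma^2[U]$ is well defined. 2. $U=-V$ is a critical point of $\sigma^2$: for every smooth $\delta U\colon\mathbb T\to\mathbb R$, $$\lim_{\varepsilon\to0}\frac{\sigma^2[-V+\varepsilon\,\delta U]-\sigma^2[-V]}{\varepsilon}=0 .$$ 3. With $m_j=\lceil j/2\rceil$, there are real numbers $a_j,b_j$ such that, almost everywhere, $f_j(x)=e^{V(x)}\bigl(a_j\sin(m_jx)+b_j\cos(m_jx)\bigr)$; the solution of the Poisson equation for $f_j$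 at $U=-V$ is $\phi_j(x)=m_j^{-2}\bigl(a_j\sin(m_jx)+b_j\cos(m_jx)\bigr)$; and $\sum_{j=1}^J\lambda_j|\phi_j'|^2$ is constant on $\mathbb T$. -/

import Mathlib

open MeasureTheory ProbabilityTheory

namespace BiasedLangevin

noncomputable section

instance fact_two_pi_pos : Fact (0 < 2 * Real.pi) := ⟨Real.two_pi_pos⟩

/-- The torus `ℝ / 2πℤ`. Its `volume` is the Lebesgue measure, of total mass `2π`. -/
abbrev Torus : Type := AddCircle (2 * Real.pi)

/-- Smooth real functions on the torus. -/
def IsSmooth (ψ : Torus → ℝ) : Prop :=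
  ContDiff ℝ (⊤ : ℕ∞) (fun x : ℝ => ψ (x : Torus))

/-- The derivative of a function on the torus. -/
def torusDeriv (ψ : Torus → ℝ) (x : Torus) : ℝ :=
  deriv (fun t : ℝ => ψ (x + (t : Torus))) 0

/-- `x ↦ cos (m x)` on the torus. -/
def cosMode (m : ℕ) (x : Torus) : ℝ := (fourier (m : ℤ) x).re

/-- `x ↦ sin (m x)` on the torus. -/
def sinMode (m : ℕ) (x : Torus) : ℝ := (fourier (m : ℤ) x).im

/-! ### Asymptotic variance -/

/-- The normalization constant `Z[U] = ∫ exp (-V - U)`; `Z = Z[0]`. -/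
def partitionFn (V U : Torus → ℝ) : ℝ := ∫ x, Real.exp (-V x - U x)

/-- The probability measure `μ_U` with density `exp (-V - U) / Z[U]`; `μ = μ_0`. -/
def gibbs (V U : Torus → ℝ) : Measure Torus := volume.tilted (fun x => -V x - U x)

/-- `g` is the weak derivative of `φ` on the torus. -/
def HasWeakDeriv (φ g : Torus → ℝ) : Prop :=
  Integrable φ ∧ Integrable g ∧
    ∀ ψ : Torus → ℝ, IsSmooth ψ → ∫ x, φ x * torusDeriv ψ x = -∫ x, g x * ψ x

/-- `φ ∈ H¹(μ_U) ∩ L²₀(μ_U)`, with weak derivative `g`, is a weak solution of the Poisson equation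
`-L_U φ = (f - I) exp U`, where `I = μ(f)` and `L_U = exp (V + U) ∇ · (exp (-V - U) ∇ ·)`. -/
structure IsPoissonSolution (V U f φ g : Torus → ℝ) : Prop where
  memLp : MemLp φ 2 (gibbs V U)
  mean_zero : ∫ x, φ x ∂(gibbs V U) = 0
  weakDeriv : HasWeakDeriv φ g
  memLp_deriv : MemLp g 2 (gibbs V U)
  weak_eq : ∀ ψ : Torus → ℝ, IsSmooth ψ →
    ∫ x, g x * torusDeriv ψ x ∂(gibbs V U) =
      ∫ x, (f x - ∫ y, f y ∂(gibbs V 0)) * Real.exp (U x) * ψ x ∂(gibbs V U)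

open Classical in
/-- The asymptotic variance `σ²_f[U] = 2 Z[U]² / Z² ∫ |∇φ_U|² dμ_U`, where `φ_U` is the solution of
the Poisson equation (and `0` by convention if there is none). -/
def asymVar (V f U : Torus → ℝ) : ℝ :=
  if h : ∃ p : (Torus → ℝ) × (Torus → ℝ), IsPoissonSolution V U f p.1 p.2 then
    2 * partitionFn V U ^ 2 / partitionFn V 0 ^ 2 * ∫ x, h.choose.2 x ^ 2 ∂(gibbs V U)
  else 0

/-- The observable `∑ j, √λ_j u_j f_j` with coefficients `u`. -/
def observable {J : ℕ} (lam : Fin J → ℝ) (f : Fin J → Torus → ℝ) (u : Fin J → ℝ) : Torus → ℝ :=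
  fun x => ∑ j, Real.sqrt (lam j) * u j * f j x

/-- The standard Gaussian measure on `ℝ^J`. -/
def stdGaussian (J : ℕ) : Measure (Fin J → ℝ) := Measure.pi (fun _ => gaussianReal 0 1)

/-- The averaged asymptotic variance `σ²[U]`: the expectation of `σ²_f[U]` for the random observable
`f = ∑ j, √λ_j u_j f_j` with independent `u_j ∼ N(0, 1)`. -/
def avgAsymVar {J : ℕ} (V : Torus → ℝ) (lam : Fin J → ℝ) (f : Fin J → Torus → ℝ)
    (U : Torus → ℝ) : ℝ :=
  ∫ u, asymVar V (observable lam f u) U ∂(stdGaussian J)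

/-- `U` is a critical point of the functional `E`: the directional derivative of `E` at `U` exists
and vanishes in every smooth direction. -/
def IsCriticalPoint (E : (Torus → ℝ) → ℝ) (U : Torus → ℝ) : Prop :=
  ∀ δU : Torus → ℝ, IsSmooth δU →
    HasDerivAt (fun ε : ℝ => E (fun x => U x + ε * δU x)) 0 0

/-! ### The operator `K = exp V (-Δ + τ²)^(-α) exp (-V)` -/

/-- `(-Δ + τ²)^(-α)` on `L²` of the torus, by functional calculus: it multiplies the `k`-th Fourier
coefficient by `(k² + τ²)^(-α)`; the Fourier series is summed in `L²`. (The value of the multiplier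
at `k = 0` does not matter, as the operator is only applied to functions of mean zero.) -/
def invPowLaplacian (τ α : ℝ) (h : Torus → ℝ) : Torus → ℝ := fun x =>
  ((∑' k : ℤ, ((((k : ℝ) ^ 2 + τ ^ 2) ^ (-α) : ℝ) * fourierCoeff (fun y => (h y : ℂ)) k : ℂ) •
    fourierLp 2 k : Lp ℂ 2 (@AddCircle.haarAddCircle (2 * Real.pi) _)) x).re

/-- The operator `K = exp V (-Δ + τ²)^(-α) exp (-V)`. -/
def opK (V : Torus → ℝ) (τ α : ℝ) (f : Torus → ℝ) : Torus → ℝ := fun x =>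
  Real.exp (V x) * invPowLaplacian τ α (fun y => Real.exp (-V y) * f y) x

/-- The space `{f ∈ L²(exp (-2V)) : ∫ f exp (-V) = 0}` on which `K` acts. -/
def MemSpace (V f : Torus → ℝ) : Prop :=
  MemLp f 2 (volume.withDensity (fun x => ENNReal.ofReal (Real.exp (-2 * V x)))) ∧
    ∫ x, f x * Real.exp (-V x) = 0

/-- The inner product of `L²(exp (-2V))`. -/
def innerV (V f g : Torus → ℝ) : ℝ := ∫ x, f x * g x * Real.exp (-2 * V x)

/-- `f` is an eigenfunction of `K` for the eigenvalue `ν`. -/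
structure IsEigenpair (V : Torus → ℝ) (τ α : ℝ) (f : Torus → ℝ) (ν : ℝ) : Prop where
  mem : MemSpace V f
  ne_zero : ¬ f =ᵐ[volume] 0
  eigen : opK V τ α f =ᵐ[volume] fun x => ν * f x

/-- `(f j, lam j)` are the first `J` eigenpairs of `K`: eigenvalues are listed in nonincreasing
order with multiplicity, the eigenfunctions are orthogonal in `L²(exp (-2V))` and have a common norm
(so orthonormal up to a common factor), and no eigenfunction orthogonal to all of them has a larger
eigenvalue. -/
structure IsFirstEigenpairs {J : ℕ} (V : Torus → ℝ) (τ α : ℝ) (f : Fin J → Torus → ℝ)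
    (lam : Fin J → ℝ) : Prop where
  eigenpair : ∀ j, IsEigenpair V τ α (f j) (lam j)
  antitone : Antitone lam
  orthogonal : ∀ i j, i ≠ j → innerV V (f i) (f j) = 0
  norm_eq : ∀ i j, innerV V (f i) (f i) = innerV V (f j) (f j)
  first : ∀ (g : Torus → ℝ) (ν : ℝ), IsEigenpair V τ α g ν →
    (∀ j, innerV V (f j) g = 0) → ∀ j, ν ≤ lam j

end

end BiasedLangevin

namespace BiasedLangevin

/-! ### Calculus on the torus -/

/-! Conjugation by $e^V$ turns $\mathcal K$ into an even Fourier multiplier, strictly decreasing in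
the positive frequencies. On mean-zero functions its eigenspaces are therefore the planes spanned by
$\sin mx,\cos mx$ (`IsEigenpair.exists_trig`). Orthogonality allows at most two eigenfunctions per
plane, and maximality forbids skipping any direction, so the frequencies are $1,1,2,2,\dots$
(`IsFirstEigenpairs.exists_trig`). For even $J$ every plane that occurs is filled by an orthogonal
pair of equal norms.

In one dimension the Poisson equation integrates explicitly. If $f=e^Vh$ and $G'=-h$, then
$\phi'=e^{V+U}(G+c)$, with $c$ fixed by $\int\phi'=0$. Hence (`asymVar_eq`)
$$\sigma_f^2[U]=\frac{2Z[U]}{Z^2}\Bigl(\int e^{V+U}G^2-\frac{(\int e^{V+U}G)^2}{\int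
e^{V+U}}\Bigr).$$ This is quadratic in the Gaussian coefficients, so averaging keeps only the
diagonal terms, weighted by $\lambda_j$. Because the planes are full, $\sum_j\lambda_jG_j^2$ is a
constant $C$ (`sq_add_sq_of_orthogonal`, `sum_eq_const_of_pairing`).

Along $U=-V+\varepsilon\,\delta U$ put $A(\varepsilon)=\int e^{\varepsilon\delta U}$ and
$B_j(\varepsilon)=\int e^{\varepsilon\delta U}G_j$. The average becomes
$\frac{2}{Z^2}A(-\varepsilon)\bigl(CA(\varepsilon)-\sum_j\lambda_jB_j(\varepsilon)^2/A(\varepsilon)\bigr)$.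
The product $A(-\varepsilon)A(\varepsilon)$ is even, and $B_j(0)=\int G_j=0$ makes the other term
second order, so the derivative at $0$ vanishes (`isCriticalPoint_neg`). -/

/-- `u'` is the continuous classical derivative of `u` on the torus. -/
structure HasTorusDeriv (u u' : Torus → ℝ) : Prop where
  continuous_deriv : Continuous u'
  hasDerivAt : ∀ t : ℝ, HasDerivAt (fun s : ℝ => u (s : Torus)) (u' (t : Torus)) t

theorem continuous_torus_iff {u : Torus → ℝ} :
    Continuous u ↔ Continuous fun s : ℝ => u (s : Torus) :=
  (QuotientAddGroup.isQuotientMap_mk (N := AddSubgroup.zmultiples (2 * Real.pi))).continuous_iff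

theorem HasTorusDeriv.continuous {u u' : Torus → ℝ} (h : HasTorusDeriv u u') : Continuous u :=
  continuous_torus_iff.2 <| continuous_iff_continuousAt.2 fun t => (h.hasDerivAt t).continuousAt

theorem torusDeriv_coe (ψ : Torus → ℝ) (t : ℝ) :
    torusDeriv ψ (t : Torus) = deriv (fun s : ℝ => ψ (s : Torus)) t := by
  have := deriv_comp_const_add (f := fun s : ℝ => ψ (s : Torus)) t 0
  simpa [torusDeriv] using this

theorem HasTorusDeriv.torusDeriv_eq {u u' : Torus → ℝ} (h : HasTorusDeriv u u') :
    torusDeriv u = u' := by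
  ext x
  obtain ⟨t, rfl⟩ := QuotientAddGroup.mk_surjective x
  exact (torusDeriv_coe u t).trans (h.hasDerivAt t).deriv

theorem IsSmooth.hasTorusDeriv {ψ : Torus → ℝ} (h : IsSmooth ψ) :
    HasTorusDeriv ψ (torusDeriv ψ) where
  continuous_deriv := by
    rw [continuous_torus_iff]
    simp_rw [torusDeriv_coe]
    exact ContDiff.continuous_deriv h (by simp)
  hasDerivAt t := by
    rw [torusDeriv_coe]
    exact (ContDiff.differentiable h (by simp) t).hasDerivAt

theorem IsSmooth.continuous {ψ : Torus → ℝ} (h : IsSmooth ψ) : Continuous ψ :=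
  h.hasTorusDeriv.continuous

theorem _root_.Continuous.torus_integrable {u : Torus → ℝ} (h : Continuous u) : Integrable u :=
  h.integrable_of_hasCompactSupport (HasCompactSupport.of_compactSpace u)

theorem _root_.Continuous.torus_memLp {u : Torus → ℝ} (h : Continuous u) (p : ENNReal)
    (μ : Measure Torus) [IsFiniteMeasure μ] : MemLp u p μ := by
  obtain ⟨C, hC⟩ := isCompact_univ.exists_bound_of_continuousOn h.continuousOn
  exact MemLp.of_bound h.aestronglyMeasurable C (Filter.Eventually.of_forall fun x => hC x trivial)

theorem integral_torus_eq (u : Torus → ℝ) :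
    ∫ x, u x = ∫ t in (0 : ℝ)..2 * Real.pi, u (t : Torus) := by
  have := AddCircle.intervalIntegral_preimage (2 * Real.pi) 0 u
  rw [zero_add] at this
  exact this.symm

theorem HasTorusDeriv.integral_mul {u u' v v' : Torus → ℝ} (hu : HasTorusDeriv u u')
    (hv : HasTorusDeriv v v') : ∫ x, u x * v' x = -∫ x, u' x * v x := by
  rw [integral_torus_eq, integral_torus_eq]
  have hc : ((2 * Real.pi : ℝ) : Torus) = ((0 : ℝ) : Torus) := by simp
  have h := intervalIntegral.integral_mul_deriv_eq_deriv_mul (a := 0) (b := 2 * Real.pi)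
    (fun t _ => hu.hasDerivAt t) (fun t _ => hv.hasDerivAt t)
    ((continuous_torus_iff.1 hu.continuous_deriv).intervalIntegrable _ _)
    ((continuous_torus_iff.1 hv.continuous_deriv).intervalIntegrable _ _)
  rw [h, hc]
  ring

theorem HasTorusDeriv.add_const {u u' : Torus → ℝ} (h : HasTorusDeriv u u') (c : ℝ) :
    HasTorusDeriv (fun x => u x + c) u' where
  continuous_deriv := h.continuous_deriv
  hasDerivAt t := (h.hasDerivAt t).add_const c

theorem HasTorusDeriv.const_mul {u u' : Torus → ℝ} (c : ℝ) (h : HasTorusDeriv u u') :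
    HasTorusDeriv (fun x => c * u x) (fun x => c * u' x) where
  continuous_deriv := h.continuous_deriv.const_mul c
  hasDerivAt t := (h.hasDerivAt t).const_mul c

theorem HasTorusDeriv.add {u u' v v' : Torus → ℝ} (hu : HasTorusDeriv u u')
    (hv : HasTorusDeriv v v') :
    HasTorusDeriv (fun x => u x + v x) (fun x => u' x + v' x) where
  continuous_deriv := hu.continuous_deriv.add hv.continuous_deriv
  hasDerivAt t := (hu.hasDerivAt t).add (hv.hasDerivAt t)

theorem HasTorusDeriv.sum {ι : Type*} (s : Finset ι) {u u' : ι → Torus → ℝ}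
    (h : ∀ i ∈ s, HasTorusDeriv (u i) (u' i)) :
    HasTorusDeriv (fun x => ∑ i ∈ s, u i x) (fun x => ∑ i ∈ s, u' i x) where
  continuous_deriv := continuous_finsetSum _ fun i hi => (h i hi).continuous_deriv
  hasDerivAt t := HasDerivAt.fun_sum fun i hi => (h i hi).hasDerivAt t

/-- A continuous function of mean zero on the torus has an antiderivative. -/
theorem exists_hasTorusDeriv {g : Torus → ℝ} (hg : Continuous g) (h0 : ∫ x, g x = 0) :
    ∃ φ : Torus → ℝ, HasTorusDeriv φ g := by
  have hc := continuous_torus_iff.1 hg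
  have hper : Function.Periodic (fun t : ℝ => g (t : Torus)) (2 * Real.pi) := fun t => by simp
  -- The primitive grows over a period by the total integral, which is zero, so it descends to the
  -- torus.
  have hP : Function.Periodic (fun t : ℝ => ∫ s in (0 : ℝ)..t, g (s : Torus)) (2 * Real.pi) := by
    intro t
    have h1 := hper.intervalIntegral_add_eq t 0
    rw [zero_add, ← integral_torus_eq, h0] at h1
    have h2 := intervalIntegral.integral_add_adjacent_intervals (μ := volume)
      (hc.intervalIntegrable 0 t) (hc.intervalIntegrable t (t + 2 * Real.pi))
    dsimp only
    rw [← h2, h1, add_zero]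
  refine ⟨hP.lift, hg, fun t => ?_⟩
  simp only [Function.Periodic.lift_coe]
  exact hc.integral_hasStrictDerivAt 0 t |>.hasDerivAt

/-! ### The trigonometric modes -/

theorem fourier_coe_eq (m : ℕ) (t : ℝ) :
    fourier (m : ℤ) (t : Torus) = Complex.exp (((m * t : ℝ) : ℂ) * Complex.I) := by
  rw [fourier_coe_apply]
  congr 1
  have : (Real.pi : ℂ) ≠ 0 := by exact_mod_cast Real.pi_ne_zero
  push_cast
  field_simp

theorem cosMode_coe (m : ℕ) (t : ℝ) : cosMode m (t : Torus) = Real.cos (m * t) := by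
  rw [cosMode, fourier_coe_eq, Complex.exp_ofReal_mul_I_re]

theorem sinMode_coe (m : ℕ) (t : ℝ) : sinMode m (t : Torus) = Real.sin (m * t) := by
  rw [sinMode, fourier_coe_eq, Complex.exp_ofReal_mul_I_im]

theorem isSmooth_cosMode (m : ℕ) : IsSmooth (cosMode m) := by
  unfold IsSmooth
  simp_rw [cosMode_coe]
  fun_prop

theorem isSmooth_sinMode (m : ℕ) : IsSmooth (sinMode m) := by
  unfold IsSmooth
  simp_rw [sinMode_coe]
  fun_prop

theorem isSmooth_const (c : ℝ) : IsSmooth fun _ => c := by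
  unfold IsSmooth
  fun_prop

theorem hasTorusDeriv_cosMode (m : ℕ) :
    HasTorusDeriv (cosMode m) (fun x => -(m * sinMode m x)) where
  continuous_deriv := ((isSmooth_sinMode m).continuous.const_mul _).neg
  hasDerivAt t := by
    simp_rw [cosMode_coe, sinMode_coe]
    convert ((hasDerivAt_id' t).const_mul (m : ℝ)).cos using 1
    ring

theorem hasTorusDeriv_sinMode (m : ℕ) :
    HasTorusDeriv (sinMode m) (fun x => m * cosMode m x) where
  continuous_deriv := (isSmooth_cosMode m).continuous.const_mul _
  hasDerivAt t := by
    simp_rw [cosMode_coe, sinMode_coe]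
    convert ((hasDerivAt_id' t).const_mul (m : ℝ)).sin using 1
    ring

theorem sinMode_sq_add_cosMode_sq (m : ℕ) (x : Torus) : sinMode m x ^ 2 + cosMode m x ^ 2 = 1 := by
  obtain ⟨t, rfl⟩ := QuotientAddGroup.mk_surjective x
  have h1 := cosMode_coe m t
  have h2 := sinMode_coe m t
  exact (by rw [h1, h2]; exact Real.sin_sq_add_cos_sq _ :
    sinMode m (t : Torus) ^ 2 + cosMode m (t : Torus) ^ 2 = 1)

/-! ### Fourier coefficients of real functions -/

/-- Fourier coefficients of a real function on the torus. -/
noncomputable def realFourierCoeff (h : Torus → ℝ) (k : ℤ) : ℂ :=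
  fourierCoeff (fun y => (h y : ℂ)) k

theorem volume_eq_smul_haar :
    (volume : Measure Torus) = ENNReal.ofReal (2 * Real.pi) • AddCircle.haarAddCircle :=
  AddCircle.volume_eq_smul_haarAddCircle

theorem ae_haar_iff {p : Torus → Prop} :
    (∀ᵐ x ∂(AddCircle.haarAddCircle : Measure Torus), p x) ↔ ∀ᵐ x : Torus, p x := by
  rw [volume_eq_smul_haar, Measure.ae_ennreal_smul_measure_iff]
  simp [Real.pi_pos]

theorem memLp_ofReal_haar {h : Torus → ℝ} (hh : MemLp h 2) :
    MemLp (fun y => (h y : ℂ)) 2 (AddCircle.haarAddCircle : Measure Torus) :=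
  memLp_haarAddCircle_iff.2 hh.ofReal

theorem fourierCoeff_congr_volume {h g : Torus → ℂ} (hg : h =ᵐ[volume] g) :
    fourierCoeff h = fourierCoeff g :=
  fourierCoeff_congr_ae (ae_haar_iff.2 hg)

theorem realFourierCoeff_congr {h g : Torus → ℝ} (hg : h =ᵐ[volume] g) :
    realFourierCoeff h = realFourierCoeff g := by
  unfold realFourierCoeff
  ext k
  exact congrFun (fourierCoeff_congr_volume (hg.mono fun x hx => congrArg Complex.ofReal hx)) k

theorem fourierCoeff_conj (h : Torus → ℂ) (k : ℤ) :
    fourierCoeff (fun y => (starRingEnd ℂ) (h y)) k = (starRingEnd ℂ) (fourierCoeff h (-k)) := by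
  unfold fourierCoeff
  rw [← integral_conj]
  congr 1
  ext t
  rw [smul_eq_mul, smul_eq_mul, map_mul, ← fourier_neg, neg_neg]

/-- Conjugate symmetry lets later arguments treat nonnegative frequencies only. -/
theorem realFourierCoeff_neg (h : Torus → ℝ) (k : ℤ) :
    realFourierCoeff h (-k) = (starRingEnd ℂ) (realFourierCoeff h k) := by
  have := fourierCoeff_conj (fun y => (h y : ℂ)) (-k)
  simpa [realFourierCoeff] using this

theorem fourierCoeff_eq_zero_imp {h : Torus → ℂ}
    (hh : MemLp h 2 (AddCircle.haarAddCircle : Measure Torus)) (h0 : ∀ k, fourierCoeff h k = 0) :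
    h =ᵐ[volume] 0 := by
  rw [Filter.EventuallyEq, ← ae_haar_iff]
  have : hh.toLp h = 0 := by
    apply (fourierBasis (T := 2 * Real.pi)).repr.injective
    ext k
    rw [fourierBasis_repr, fourierCoeff_congr_ae hh.coeFn_toLp, h0]
    simp
  exact hh.coeFn_toLp.symm.trans (this ▸ Lp.coeFn_zero _ _ _)

theorem realFourierCoeff_sub {h g : Torus → ℝ} (hh : MemLp h 2) (hg : MemLp g 2) (k : ℤ) :
    realFourierCoeff (fun x => h x - g x) k = realFourierCoeff h k - realFourierCoeff g k := by
  have h1 := (memLp_ofReal_haar hh).integrable (by norm_num)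
  have h2 := (memLp_ofReal_haar hg).integrable (by norm_num)
  have := integral_sub (h1.fourier_smul (-k)) (h2.fourier_smul (-k))
  simpa [realFourierCoeff, fourierCoeff, -fourier_apply, mul_sub] using this

theorem ae_eq_of_realFourierCoeff {h g : Torus → ℝ} (hh : MemLp h 2) (hg : MemLp g 2)
    (heq : ∀ k, realFourierCoeff h k = realFourierCoeff g k) : h =ᵐ[volume] g := by
  have := fourierCoeff_eq_zero_imp (memLp_ofReal_haar (hh.sub hg)) fun k =>
    (realFourierCoeff_sub hh hg k).trans (sub_eq_zero.2 (heq k))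
  filter_upwards [this] with x hx
  exact sub_eq_zero.1 (Complex.ofReal_eq_zero.1 hx)

theorem realFourierCoeff_natCast {h : Torus → ℝ} (hh : MemLp h 2) (m : ℕ) :
    realFourierCoeff h m = (2 * Real.pi : ℝ)⁻¹ *
      (((∫ x, h x * cosMode m x : ℝ) : ℂ) - Complex.I * ((∫ x, h x * sinMode m x : ℝ) : ℂ)) := by
  have hi := hh.integrable (by norm_num)
  have hc : Integrable fun x => h x * cosMode m x :=
    hh.integrable_mul ((isSmooth_cosMode m).continuous.torus_memLp 2 _)
  have hs : Integrable fun x => h x * sinMode m x :=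
    hh.integrable_mul ((isSmooth_sinMode m).continuous.torus_memLp 2 _)
  unfold realFourierCoeff fourierCoeff
  rw [AddCircle.integral_haarAddCircle, ← integral_complex_ofReal, ← integral_complex_ofReal,
    ← integral_const_mul, ← integral_sub hc.ofReal (hs.ofReal.const_mul _)]
  rw [Complex.real_smul]
  congr 1
  refine integral_congr_ae (Filter.Eventually.of_forall fun x => ?_)
  simp only [cosMode, sinMode, fourier_neg, smul_eq_mul]
  apply Complex.ext <;> simp [-fourier_apply] <;> ring

theorem integral_mul_cosMode {h : Torus → ℝ} (hh : MemLp h 2) (m : ℕ) :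
    ∫ x, h x * cosMode m x = 2 * Real.pi * (realFourierCoeff h m).re := by
  rw [realFourierCoeff_natCast hh]
  have := Real.pi_ne_zero
  simp [-fourier_apply]
  field_simp

theorem integral_mul_sinMode {h : Torus → ℝ} (hh : MemLp h 2) (m : ℕ) :
    ∫ x, h x * sinMode m x = -(2 * Real.pi * (realFourierCoeff h m).im) := by
  rw [realFourierCoeff_natCast hh]
  have := Real.pi_ne_zero
  simp [-fourier_apply]
  field_simp

/-- The general trigonometric function of frequency `n`. -/
noncomputable def trig (n : ℕ) (a b : ℝ) (x : Torus) : ℝ := a * sinMode n x + b * cosMode n x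

theorem continuous_trig (n : ℕ) (a b : ℝ) : Continuous (trig n a b) :=
  ((isSmooth_sinMode n).continuous.const_mul a).add ((isSmooth_cosMode n).continuous.const_mul b)

theorem memLp_trig (n : ℕ) (a b : ℝ) : MemLp (trig n a b) 2 :=
  (continuous_trig n a b).torus_memLp 2 _

/-- Euler's formula. Two separate indicators are kept so that $n=0$ is covered as well: there they
add up to the constant $b$. -/
theorem realFourierCoeff_trig (n : ℕ) (a b : ℝ) (k : ℤ) :
    realFourierCoeff (trig n a b) k =
      ((b - Complex.I * a) * (if k = n then 1 else 0) +
        (b + Complex.I * a) * (if k = -n then 1 else 0)) / 2 := by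
  have h1 : Integrable (fun x : Torus => fourier (-k) x • fourier (n : ℤ) x)
    AddCircle.haarAddCircle := Integrable.fourier_smul
      (Continuous.integrable_of_hasCompactSupport (map_continuous _)
        (HasCompactSupport.of_compactSpace _)) (-k)
  have h2 : Integrable (fun x : Torus => fourier (-k) x • fourier (-(n : ℤ)) x)
    AddCircle.haarAddCircle := Integrable.fourier_smul
      (Continuous.integrable_of_hasCompactSupport (map_continuous _)
        (HasCompactSupport.of_compactSpace _)) (-k)
  have e1 : ∫ x : Torus, fourier (-k) x • fourier (n : ℤ) x ∂AddCircle.haarAddCircle =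
      if k = n then 1 else 0 := by
    have := congrFun (fourierCoeff_fourier (T := 2 * Real.pi) n) k
    rw [Pi.single_apply] at this
    exact this
  have e2 : ∫ x : Torus, fourier (-k) x • fourier (-(n : ℤ)) x ∂AddCircle.haarAddCircle =
      if k = -n then 1 else 0 := by
    have := congrFun (fourierCoeff_fourier (T := 2 * Real.pi) (-n)) k
    rw [Pi.single_apply] at this
    exact this
  rw [← e1, ← e2, ← integral_const_mul, ← integral_const_mul,
    ← integral_add (h1.const_mul _) (h2.const_mul _), ← integral_div]
  unfold realFourierCoeff fourierCoeff
  refine integral_congr_ae (Filter.Eventually.of_forall fun x => ?_)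
  simp only [trig, sinMode, cosMode, smul_eq_mul]
  have : (a * (fourier (n : ℤ) x).im + b * (fourier (n : ℤ) x).re : ℂ) =
      ((b - Complex.I * a) * fourier (n : ℤ) x +
        (b + Complex.I * a) * fourier (-(n : ℤ)) x) / 2 := by
    rw [fourier_neg]
    apply Complex.ext <;> simp [-fourier_apply] <;> ring
  push_cast
  rw [this]
  ring

theorem realFourierCoeff_trig_natCast {n m : ℕ} (hm : m ≠ 0) (a b : ℝ) :
    realFourierCoeff (trig n a b) m = if m = n then (b - Complex.I * a) / 2 else 0 := by
  rw [realFourierCoeff_trig, if_neg (by omega : ¬ (m : ℤ) = -n)]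
  by_cases h : m = n <;> simp [h]

theorem integral_trig_mul_cosMode {n m : ℕ} (hm : m ≠ 0) (a b : ℝ) :
    ∫ x, trig n a b x * cosMode m x = if m = n then Real.pi * b else 0 := by
  rw [integral_mul_cosMode (memLp_trig n a b), realFourierCoeff_trig_natCast hm]
  by_cases h : m = n <;> simp [h]
  ring

theorem integral_trig_mul_sinMode {n m : ℕ} (hm : m ≠ 0) (a b : ℝ) :
    ∫ x, trig n a b x * sinMode m x = if m = n then Real.pi * a else 0 := by
  rw [integral_mul_sinMode (memLp_trig n a b), realFourierCoeff_trig_natCast hm]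
  by_cases h : m = n <;> simp [h]
  ring

theorem integral_trig_mul_trig {n m : ℕ} (hm : m ≠ 0) (a b c d : ℝ) :
    ∫ x, trig n a b x * trig m c d x = if n = m then Real.pi * (a * c + b * d) else 0 := by
  have h1 : Integrable fun x => trig n a b x * sinMode m x :=
    ((continuous_trig n a b).mul (isSmooth_sinMode m).continuous).torus_integrable
  have h2 : Integrable fun x => trig n a b x * cosMode m x :=
    ((continuous_trig n a b).mul (isSmooth_cosMode m).continuous).torus_integrable
  have : ∀ x, trig n a b x * trig m c d x =
      c * (trig n a b x * sinMode m x) + d * (trig n a b x * cosMode m x) := fun x => by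
    simp only [trig]; ring
  simp_rw [this]
  rw [integral_add (h1.const_mul c) (h2.const_mul d), integral_const_mul, integral_const_mul,
    integral_trig_mul_cosMode hm, integral_trig_mul_sinMode hm]
  by_cases h : n = m
  · simp only [h, if_true]; ring
  · simp [h, Ne.symm h]

theorem integral_trig {n : ℕ} (hn : n ≠ 0) (a b : ℝ) : ∫ x, trig n a b x = 0 := by
  have := integral_trig_mul_trig hn 0 1 a b (n := 0)
  rw [if_neg (Ne.symm hn)] at this
  simpa [trig, cosMode, sinMode] using this

/-- A function with all Fourier coefficients outside `±n` equal to zero is trigonometric. -/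
theorem exists_ae_eq_trig {h : Torus → ℝ} (hh : MemLp h 2) {n : ℕ} (hn : n ≠ 0)
    (h0 : ∀ k : ℤ, k ≠ n → k ≠ -n → realFourierCoeff h k = 0) :
    ∃ a b : ℝ, h =ᵐ[volume] trig n a b := by
  -- These values solve $\hat h(n)=(b-ia)/2$ for real $a,b$.
  refine ⟨-(2 * (realFourierCoeff h n).im), 2 * (realFourierCoeff h n).re,
    ae_eq_of_realFourierCoeff hh (memLp_trig _ _ _) fun k => ?_⟩
  rw [realFourierCoeff_trig]
  by_cases h1 : k = n
  · subst h1
    rw [if_pos rfl, if_neg (by omega)]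
    apply Complex.ext <;> simp
  by_cases h2 : k = -n
  · subst h2
    rw [if_pos rfl, if_neg (by omega), realFourierCoeff_neg]
    apply Complex.ext <;> simp
    ring
  · simp [h0 k h1 h2, h1, h2]

/-- An `L²` function orthogonal to the derivatives of all smooth functions is constant. -/
theorem ae_eq_const_of_integral_mul_torusDeriv {w : Torus → ℝ} (hw : MemLp w 2)
    (h : ∀ ψ, IsSmooth ψ → ∫ x, w x * torusDeriv ψ x = 0) :
    ∃ c : ℝ, w =ᵐ[volume] fun _ => c := by
  -- Testing against $\sin mx$ and $\cos mx$ already kills every nonzero frequency.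
  have hpos : ∀ m : ℕ, m ≠ 0 → realFourierCoeff w m = 0 := by
    intro m hm
    have hm' : (m : ℝ) ≠ 0 := by exact_mod_cast hm
    have h1 := h _ (isSmooth_sinMode m)
    have h2 := h _ (isSmooth_cosMode m)
    rw [(hasTorusDeriv_sinMode m).torusDeriv_eq] at h1
    rw [(hasTorusDeriv_cosMode m).torusDeriv_eq] at h2
    have h1' : (m : ℝ) * ∫ x, w x * cosMode m x = 0 := by
      rw [← integral_const_mul, ← h1]; congr 1; ext x; ring
    have h2' : -(m : ℝ) * ∫ x, w x * sinMode m x = 0 := by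
      rw [← integral_const_mul, ← h2]; congr 1; ext x; ring
    have h1'' := (mul_eq_zero.1 h1').resolve_left hm'
    have h2'' := (mul_eq_zero.1 h2').resolve_left (neg_ne_zero.2 hm')
    rw [realFourierCoeff_natCast hw, h1'', h2'']
    simp
  have hz : ∀ k : ℤ, k ≠ 0 → realFourierCoeff w k = 0 := by
    intro k hk
    obtain ⟨m, rfl | rfl⟩ := k.eq_nat_or_neg
    · exact hpos m (by omega)
    · rw [realFourierCoeff_neg, hpos m (by omega), map_zero]
  refine ⟨(realFourierCoeff w 0).re, ?_⟩
  have : (fun _ : Torus => (realFourierCoeff w 0).re) = trig 0 0 (realFourierCoeff w 0).re := by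
    ext x; simp [trig, cosMode]
  rw [this]
  refine ae_eq_of_realFourierCoeff hw (memLp_trig _ _ _) fun k => ?_
  rw [realFourierCoeff_trig]
  by_cases hk : k = 0
  · subst hk
    have him := realFourierCoeff_neg w 0
    rw [neg_zero] at him
    have him' : (realFourierCoeff w 0).im = 0 := Complex.conj_eq_iff_im.1 him.symm
    apply Complex.ext <;> simp [him']
  · simp [hk, hz k hk]

/-! ### The operator `K` and its eigenpairs -/

/-- The Fourier multiplier of `(-Δ + τ²)^(-α)`. -/
noncomputable def multiplier (τ α : ℝ) (k : ℤ) : ℝ := ((k : ℝ) ^ 2 + τ ^ 2) ^ (-α)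

theorem multiplier_nonneg (τ α : ℝ) (k : ℤ) : 0 ≤ multiplier τ α k := by
  unfold multiplier
  positivity

theorem multiplier_neg (τ α : ℝ) (k : ℤ) : multiplier τ α (-k) = multiplier τ α k := by
  simp [multiplier]

/-- This separates the eigenvalues of different frequencies. Frequency $0$ is excluded: for $\tau=0$
the base vanishes there and Lean's `0 ^ (-α)` is `0`. -/
theorem multiplier_lt {α : ℝ} (τ : ℝ) (hα : 0 < α) {m n : ℕ} (hm : m ≠ 0) (hmn : m < n) :
    multiplier τ α n < multiplier τ α m := by
  have h1 : (1 : ℝ) ≤ m := by exact_mod_cast Nat.one_le_iff_ne_zero.2 hm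
  have h2 : (m : ℝ) < n := by exact_mod_cast hmn
  refine Real.rpow_lt_rpow_of_neg ?_ ?_ (by linarith)
  · simp only [Int.cast_natCast]; positivity
  · simp only [Int.cast_natCast]; nlinarith

theorem multiplier_le {α : ℝ} (τ : ℝ) (hα : 0 < α) (k : ℤ) :
    multiplier τ α k ≤ 1 + multiplier τ α 0 := by
  by_cases hk : k = 0
  · subst hk; linarith
  have h1 : (1 : ℝ) ≤ (k : ℝ) ^ 2 + τ ^ 2 := by
    have hk2 : 0 < k ^ 2 := by positivity
    have : (1 : ℝ) ≤ (k : ℝ) ^ 2 := by exact_mod_cast hk2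
    nlinarith [sq_nonneg τ]
  have := Real.rpow_le_one_of_one_le_of_nonpos h1 (by linarith : -α ≤ 0)
  have h0 := multiplier_nonneg τ α 0
  unfold multiplier at *
  linarith

/-- A bounded multiplier preserves $\ell^2$, so the defining series converges and its `tsum` is not
a default value. Taking the real part loses nothing, since the multiplier is even and $h$ is real.
-/
theorem invPowLaplacian_spec {τ α : ℝ} (hα : 0 < α) {h : Torus → ℝ} (hh : MemLp h 2) :
    MemLp (invPowLaplacian τ α h) 2 ∧ ∀ k, realFourierCoeff (invPowLaplacian τ α h) k =
      multiplier τ α k * realFourierCoeff h k := by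
  have hL := memLp_ofReal_haar hh
  have hsq : Summable fun k => ‖realFourierCoeff h k‖ ^ 2 := by
    have := (hasSum_sq_fourierCoeff hL.toLp).summable
    rwa [fourierCoeff_congr_ae hL.coeFn_toLp] at this
  have hmem : Memℓp (fun k => (multiplier τ α k * realFourierCoeff h k : ℂ)) 2 := by
    refine memℓp_gen ?_
    simp only [ENNReal.toReal_ofNat, Real.rpow_ofNat]
    refine Summable.of_nonneg_of_le (fun _ => by positivity) (fun k => ?_)
      (hsq.mul_left ((1 + multiplier τ α 0) ^ 2))
    rw [norm_mul, mul_pow, Complex.norm_real, Real.norm_of_nonneg (multiplier_nonneg _ _ _)]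
    gcongr
    · exact multiplier_nonneg _ _ _
    · exact multiplier_le τ hα k
  set S : Lp ℂ 2 (AddCircle.haarAddCircle : Measure Torus) :=
    fourierBasis.repr.symm ⟨_, hmem⟩ with hS
  have hsum := (fourierBasis (T := 2 * Real.pi)).hasSum_repr_symm ⟨_, hmem⟩
  have hcoef : ∀ k, fourierCoeff S k = multiplier τ α k * realFourierCoeff h k := by
    intro k
    rw [← fourierBasis_repr, hS, LinearIsometryEquiv.apply_symm_apply]
  have heq : invPowLaplacian τ α h = fun x => (S x).re := by
    ext x
    unfold invPowLaplacian
    rw [hS, ← hsum.tsum_eq, coe_fourierBasis]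
    rfl
  have hSm : MemLp S 2 (AddCircle.haarAddCircle : Measure Torus) := Lp.memLp S
  rw [heq]
  refine ⟨(memLp_haarAddCircle_iff.1 hSm).re, fun k => ?_⟩
  have hi := hSm.integrable (by norm_num)
  have hic : Integrable (fun x => (starRingEnd ℂ) (S x))
      (AddCircle.haarAddCircle : Measure Torus) := hSm.star.integrable (by norm_num)
  have e1 : realFourierCoeff (fun x => (S x).re) k =
      (fourierCoeff S k + fourierCoeff (fun x => (starRingEnd ℂ) (S x)) k) / 2 := by
    unfold realFourierCoeff fourierCoeff
    rw [← integral_add (hi.fourier_smul _) (hic.fourier_smul _), ← integral_div]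
    congr 1
    ext x
    dsimp only
    rw [Complex.re_eq_add_conj, smul_eq_mul, smul_eq_mul, smul_eq_mul]
    ring
  rw [e1, fourierCoeff_conj, hcoef, hcoef, multiplier_neg, realFourierCoeff_neg]
  simp

theorem realFourierCoeff_const_mul (c : ℝ) (h : Torus → ℝ) (k : ℤ) :
    realFourierCoeff (fun x => c * h x) k = c * realFourierCoeff h k := by
  unfold realFourierCoeff
  rw [← fourierCoeff.const_mul]
  simp

/-- Multiplication by $e^{-V}$ carries $L^2(e^{-2V})$ isometrically onto $L^2$, which removes the
weight from the spectral problem. -/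
theorem memSpace_iff {V : Torus → ℝ} (hV : Continuous V) {f : Torus → ℝ} :
    MemSpace V f ↔ MemLp (fun x => Real.exp (-V x) * f x) 2 ∧
      ∫ x, Real.exp (-V x) * f x = 0 := by
  have hd : Measurable fun x => ENNReal.ofReal (Real.exp (-2 * V x)) := by fun_prop
  have hac : (volume : Measure Torus) ≪
      volume.withDensity (fun x => ENNReal.ofReal (Real.exp (-2 * V x))) :=
    withDensity_absolutelyContinuous' hd.aemeasurable
      (Filter.Eventually.of_forall fun x => by simp [Real.exp_pos])
  have hac' := withDensity_absolutelyContinuous (volume : Measure Torus)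
    (fun x => ENNReal.ofReal (Real.exp (-2 * V x)))
  have hexp : Continuous fun x => Real.exp (-V x) := by fun_prop
  have hexp' : Continuous fun x => Real.exp (V x) := by fun_prop
  have hint : (Integrable (fun x => f x ^ 2)
      (volume.withDensity (fun x => ENNReal.ofReal (Real.exp (-2 * V x))))) ↔
      Integrable fun x => (Real.exp (-V x) * f x) ^ 2 := by
    rw [integrable_withDensity_iff hd (Filter.Eventually.of_forall fun x => ENNReal.ofReal_lt_top)]
    refine integrable_congr (Filter.Eventually.of_forall fun x => ?_)
    dsimp only
    rw [ENNReal.toReal_ofReal (Real.exp_pos _).le, mul_pow, ← Real.exp_nat_mul]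
    push_cast
    rw [mul_comm]
    congr 2
    ring
  unfold MemSpace
  simp_rw [mul_comm (f _)]
  refine and_congr_left fun _ => ⟨fun h => ?_, fun h => ?_⟩
  · have hm := h.aestronglyMeasurable.mono_ac hac
    rw [memLp_two_iff_integrable_sq h.aestronglyMeasurable, hint] at h
    exact (memLp_two_iff_integrable_sq (hexp.aestronglyMeasurable.mul hm)).2 h
  · have hm : AEStronglyMeasurable f volume := by
      refine (hexp'.aestronglyMeasurable.mul h.aestronglyMeasurable).congr
        (Filter.Eventually.of_forall fun x => ?_)
      simp [← mul_assoc, ← Real.exp_add]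
    rw [memLp_two_iff_integrable_sq h.aestronglyMeasurable] at h
    rwa [memLp_two_iff_integrable_sq (hm.mono_ac hac'), hint]

/-- For $g=e^{-V}f$ the eigenvalue equation reads $(\text{multiplier}(k)-\nu)\,\hat g(k)=0$. Some
positive frequency is present, since $g\ne0$ has mean zero, and strict monotonicity excludes any
other. -/
theorem IsEigenpair.exists_trig {V : Torus → ℝ} (hV : Continuous V) {τ α : ℝ} (hα : 0 < α)
    {f : Torus → ℝ} {ν : ℝ} (h : IsEigenpair V τ α f ν) :
    ∃ (n : ℕ) (a b : ℝ), n ≠ 0 ∧ ν = multiplier τ α n ∧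
      f =ᵐ[volume] fun x => Real.exp (V x) * trig n a b x := by
  obtain ⟨hmem, hne, heig⟩ := h
  obtain ⟨hL, h0⟩ := (memSpace_iff hV).1 hmem
  set g : Torus → ℝ := fun x => Real.exp (-V x) * f x with hg
  have hfg : ∀ x, f x = Real.exp (V x) * g x := fun x => by
    simp [hg, ← mul_assoc, ← Real.exp_add]
  obtain ⟨hT, hTc⟩ := invPowLaplacian_spec (τ := τ) hα hL
  have hae : invPowLaplacian τ α g =ᵐ[volume] fun x => ν * g x := by
    filter_upwards [heig] with x hx
    unfold opK at hx
    have he := (Real.exp_pos (V x)).ne'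
    rw [hfg x] at hx
    apply mul_left_cancel₀ he
    rw [hx]; ring
  have hk : ∀ k, (multiplier τ α k - ν : ℂ) * realFourierCoeff g k = 0 := by
    intro k
    have := hTc k
    rw [realFourierCoeff_congr hae, realFourierCoeff_const_mul] at this
    rw [sub_mul, ← this, sub_self]
  have hg0 : realFourierCoeff g 0 = 0 := by
    have := realFourierCoeff_natCast hL 0
    have e1 : ∫ x, g x * cosMode 0 x = 0 := by simpa [cosMode] using h0
    have e2 : ∫ x, g x * sinMode 0 x = 0 := by simp [sinMode]
    rw [e1, e2] at this
    simpa using this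
  have hex : ∃ n : ℕ, n ≠ 0 ∧ realFourierCoeff g n ≠ 0 := by
    by_contra! hcon
    refine hne ?_
    have : g =ᵐ[volume] fun _ => 0 := by
      refine ae_eq_of_realFourierCoeff hL (continuous_const.torus_memLp 2 _) fun k => ?_
      have hz : realFourierCoeff (fun _ => 0) k = 0 := by simp [realFourierCoeff, fourierCoeff]
      rw [hz]
      obtain ⟨m, rfl | rfl⟩ := k.eq_nat_or_neg
      · by_cases hm : m = 0
        · subst hm; exact hg0
        · exact hcon m hm
      · rw [realFourierCoeff_neg]
        by_cases hm : m = 0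
        · subst hm; simp [hg0]
        · simp [hcon m hm]
    filter_upwards [this] with x hx
    rw [hfg, hx]
    simp
  obtain ⟨n, hn, hgn⟩ := hex
  have hν : ∀ m : ℕ, realFourierCoeff g m ≠ 0 → multiplier τ α m = ν := fun m hm => by
    have := (mul_eq_zero.1 (hk m)).resolve_right hm
    exact_mod_cast sub_eq_zero.1 this
  have hpos : ∀ m : ℕ, m ≠ n → realFourierCoeff g m = 0 := by
    intro m hm
    by_cases hm0 : m = 0
    · subst hm0; exact hg0
    by_contra hc
    have heq := (hν m hc).trans (hν n hgn).symm
    rcases lt_or_gt_of_ne hm with hlt | hlt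
    · exact (multiplier_lt τ hα hm0 hlt).ne' heq
    · exact (multiplier_lt τ hα hn hlt).ne heq
  obtain ⟨a, b, hab⟩ := exists_ae_eq_trig hL hn fun k h1 h2 => by
    obtain ⟨m, rfl | rfl⟩ := k.eq_nat_or_neg
    · exact hpos m (by omega)
    · rw [realFourierCoeff_neg, hpos m (by omega), map_zero]
  refine ⟨n, a, b, hn, (hν n hgn).symm, ?_⟩
  filter_upwards [hab] with x hx
  rw [hfg, hx]

/-- Supplies the competitors to which the maximality condition `first` is applied. -/
theorem isEigenpair_trig {V : Torus → ℝ} (hV : Continuous V) (τ : ℝ) {α : ℝ} (hα : 0 < α)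
    {n : ℕ} (hn : n ≠ 0) {a b : ℝ} (hab : a ≠ 0 ∨ b ≠ 0) :
    IsEigenpair V τ α (fun x => Real.exp (V x) * trig n a b x) (multiplier τ α n) := by
  have hcancel : (fun x => Real.exp (-V x) * (Real.exp (V x) * trig n a b x)) = trig n a b := by
    ext x; simp [← mul_assoc, ← Real.exp_add]
  refine ⟨(memSpace_iff hV).2 ?_, fun h => ?_, ?_⟩
  · rw [hcancel]
    exact ⟨memLp_trig n a b, integral_trig hn a b⟩
  · have h0 : ∫ x, trig n a b x * trig n a b x = 0 := by
      rw [integral_eq_zero_of_ae]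
      filter_upwards [h] with x hx
      have := (mul_eq_zero.1 hx).resolve_left (Real.exp_pos _).ne'
      simp [this]
    rw [integral_trig_mul_trig hn, if_pos rfl] at h0
    have := (mul_eq_zero.1 h0).resolve_left Real.pi_ne_zero
    rcases hab with h | h
    · exact h (by nlinarith [mul_self_nonneg a, mul_self_nonneg b, mul_self_pos.2 h])
    · exact h (by nlinarith [mul_self_nonneg a, mul_self_nonneg b, mul_self_pos.2 h])
  · have hae : invPowLaplacian τ α (trig n a b) =ᵐ[volume]
        fun x => multiplier τ α n * trig n a b x := by
      obtain ⟨hT, hTc⟩ := invPowLaplacian_spec (τ := τ) hα (memLp_trig n a b)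
      refine ae_eq_of_realFourierCoeff hT ((memLp_trig n a b).const_mul _) fun k => ?_
      rw [hTc, realFourierCoeff_const_mul]
      by_cases h1 : k = n
      · rw [h1]
      by_cases h2 : k = -n
      · rw [h2, multiplier_neg]
      · simp [realFourierCoeff_trig, h1, h2]
    filter_upwards [hae] with x hx
    unfold opK
    rw [hcancel, hx]
    ring

theorem innerV_trig {V f g : Torus → ℝ} {n m : ℕ} (hm : m ≠ 0) {a b c d : ℝ}
    (hf : f =ᵐ[volume] fun x => Real.exp (V x) * trig n a b x)
    (hg : g =ᵐ[volume] fun x => Real.exp (V x) * trig m c d x) :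
    innerV V f g = if n = m then Real.pi * (a * c + b * d) else 0 := by
  rw [← integral_trig_mul_trig hm]
  refine integral_congr_ae ?_
  filter_upwards [hf, hg] with x h1 h2
  rw [h1, h2]
  have : Real.exp (V x) * Real.exp (V x) * Real.exp (-2 * V x) = 1 := by
    rw [← Real.exp_add, ← Real.exp_add, ← Real.exp_zero]
    congr 1; ring
  linear_combination (trig n a b x * trig m c d x) * this

/-! ### Ordering of the eigenpairs -/

/-- A monotone sequence of positive integers taking no value more than twice and every value below
its maximum exactly twice is `1, 1, 2, 2, …`. -/
theorem eq_half_add_one_of_card_fiber {J : ℕ} {n : Fin J → ℕ} (hmono : Monotone n)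
    (hpos : ∀ j, n j ≠ 0)
    (hle : ∀ m, (Finset.univ.filter fun j => n j = m).card ≤ 2)
    (hge : ∀ (m : ℕ) (j : Fin J), m ≠ 0 → m < n j → 2 ≤ (Finset.univ.filter fun j => n j = m).card)
    (j : Fin J) : n j = j / 2 + 1 := by
  have hcard : ∀ M : ℕ, (Finset.univ.filter fun i => n i ≤ M).card =
      ∑ m ∈ Finset.Icc 1 M, (Finset.univ.filter fun j => n j = m).card := by
    intro M
    rw [Finset.card_eq_sum_card_fiberwise (f := n) (t := Finset.Icc 1 M)]
    · refine Finset.sum_congr rfl fun m hm => ?_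
      rw [Finset.filter_filter]
      congr 1
      ext i
      simp only [Finset.mem_filter, Finset.mem_univ, true_and, Finset.mem_Icc] at hm ⊢
      omega
    · intro i hi
      have := hpos i
      simp only [Finset.coe_filter, Finset.mem_univ, true_and, Set.mem_ofPred_eq, Finset.coe_Icc,
        Set.mem_Icc] at hi ⊢
      omega
  apply le_antisymm
  -- Otherwise each of the values $1,\dots,\lfloor j/2\rfloor+1$ is taken twice, always at an index
  -- before $j$, so $2(\lfloor j/2\rfloor+1)\le j$, which is impossible.
  · by_contra! hlt
    have h1 : (Finset.univ.filter fun i => n i ≤ j / 2 + 1) ⊆ Finset.Iio j := by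
      intro i hi
      simp only [Finset.mem_filter, Finset.mem_univ, true_and, Finset.mem_Iio] at hi ⊢
      by_contra! hji
      have := hmono hji
      omega
    have h2 := Finset.card_le_card h1
    rw [hcard, Fin.card_Iio] at h2
    have h3 : ∑ m ∈ Finset.Icc 1 ((j : ℕ) / 2 + 1), 2 ≤
        ∑ m ∈ Finset.Icc 1 ((j : ℕ) / 2 + 1), (Finset.univ.filter fun j => n j = m).card :=
      Finset.sum_le_sum fun m hm => hge m j (by have := Finset.mem_Icc.1 hm; omega)
        (by have := Finset.mem_Icc.1 hm; omega)
    simp at h3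
    omega
  -- The $j+1$ indices up to $j$ take values in $1,\dots,n_j$, each at most twice, so $j+1\le 2n_j$.
  · have h1 : Finset.Iic j ⊆ (Finset.univ.filter fun i => n i ≤ n j) := by
      intro i hi
      simpa using hmono (Finset.mem_Iic.1 hi)
    have h2 := Finset.card_le_card h1
    rw [hcard, Fin.card_Iic] at h2
    have h3 : ∑ m ∈ Finset.Icc 1 (n j), (Finset.univ.filter fun j => n j = m).card ≤
        ∑ m ∈ Finset.Icc 1 (n j), 2 := Finset.sum_le_sum fun m _ => hle m
    simp at h3
    omega

/-- By Lagrange's identities, orthogonality makes $\det(v_1,v_2)\det(v_1,v_3)$ vanish, while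
$\det(v_1,v_i)^2=|v_1|^2|v_i|^2\ne0$. -/
theorem not_three_orthogonal {a₁ b₁ a₂ b₂ a₃ b₃ : ℝ} (h₁ : a₁ ^ 2 + b₁ ^ 2 ≠ 0)
    (h₂ : a₂ ^ 2 + b₂ ^ 2 ≠ 0) (h₃ : a₃ ^ 2 + b₃ ^ 2 ≠ 0) (h₁₂ : a₁ * a₂ + b₁ * b₂ = 0)
    (h₁₃ : a₁ * a₃ + b₁ * b₃ = 0) (h₂₃ : a₂ * a₃ + b₂ * b₃ = 0) : False := by
  have h : (a₁ * b₂ - b₁ * a₂) * (a₁ * b₃ - b₁ * a₃) = 0 := by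
    linear_combination (a₁ ^ 2 + b₁ ^ 2) * h₂₃ - (a₁ * a₃ + b₁ * b₃) * h₁₂
  rcases mul_eq_zero.1 h with h | h
  · refine mul_ne_zero h₁ h₂ ?_
    linear_combination (a₁ * a₂ + b₁ * b₂) * h₁₂ + (a₁ * b₂ - b₁ * a₂) * h
  · refine mul_ne_zero h₁ h₃ ?_
    linear_combination (a₁ * a₃ + b₁ * b₃) * h₁₃ + (a₁ * b₃ - b₁ * a₃) * h

/-- The matrix with rows $(a,b)$ and $(a',b')$ is $\sqrt c$ times an orthogonal matrix, so it scales
the squared norm of $(x,-y)$ by $c$. -/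
theorem sq_add_sq_of_orthogonal {a b a' b' c : ℝ} (hc : c ≠ 0) (h : a ^ 2 + b ^ 2 = c)
    (h' : a' ^ 2 + b' ^ 2 = c) (ho : a * a' + b * b' = 0) (x y : ℝ) :
    (a * x - b * y) ^ 2 + (a' * x - b' * y) ^ 2 = c * (y ^ 2 + x ^ 2) := by
  have h1 : a' ^ 2 = b ^ 2 := mul_left_cancel₀ hc (by
    linear_combination (-a' ^ 2) * h + b ^ 2 * h' + (a * a' - b * b') * ho)
  have h2 : a * b + a' * b' = 0 := mul_left_cancel₀ hc (by
    linear_combination (-a * b) * h' - a' * b' * h + (b * a' + a * b') * ho)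
  linear_combination x ^ 2 * (h1 + h) + y ^ 2 * (h' - h1) - 2 * x * y * h2

/-- The first eigenpairs of `K` are explicit. -/
theorem IsFirstEigenpairs.exists_trig {V : Torus → ℝ} (hV : Continuous V) {τ α : ℝ} (hα : 0 < α)
    {J : ℕ} {f : Fin J → Torus → ℝ} {lam : Fin J → ℝ} (hf : IsFirstEigenpairs V τ α f lam) :
    ∃ a b : Fin J → ℝ,
      (∀ j, f j =ᵐ[volume] fun x => Real.exp (V x) * trig (j / 2 + 1) (a j) (b j) x) ∧
      (∀ j, lam j = multiplier τ α ((j / 2 + 1 : ℕ) : ℤ)) ∧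
      (∀ j, a j ^ 2 + b j ^ 2 ≠ 0) ∧
      (∀ i j, a i ^ 2 + b i ^ 2 = a j ^ 2 + b j ^ 2) ∧
      (∀ i j : Fin J, i ≠ j → (i : ℕ) / 2 = j / 2 → a i * a j + b i * b j = 0) := by
  choose n a b hn hlam hfj using fun j => (hf.eigenpair j).exists_trig hV hα
  have hinner : ∀ i j, innerV V (f i) (f j) =
      if n i = n j then Real.pi * (a i * a j + b i * b j) else 0 :=
    fun i j => innerV_trig (hn j) (hfj i) (hfj j)
  have horth : ∀ i j, i ≠ j → n i = n j → a i * a j + b i * b j = 0 := fun i j hij hnij => by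
    have := hf.orthogonal i j hij
    rw [hinner, if_pos hnij] at this
    exact (mul_eq_zero.1 this).resolve_left Real.pi_ne_zero
  have hne : ∀ j, a j ^ 2 + b j ^ 2 ≠ 0 := fun j h0 => by
    have ha : a j = 0 := by nlinarith [sq_nonneg (a j), sq_nonneg (b j)]
    have hb : b j = 0 := by nlinarith [sq_nonneg (a j), sq_nonneg (b j)]
    refine (hf.eigenpair j).ne_zero ?_
    filter_upwards [hfj j] with x hx
    simp [hx, ha, hb, trig]
  have hnorm : ∀ i j, a i ^ 2 + b i ^ 2 = a j ^ 2 + b j ^ 2 := fun i j => by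
    have := hf.norm_eq i j
    rw [hinner, hinner, if_pos rfl, if_pos rfl] at this
    have := mul_left_cancel₀ Real.pi_ne_zero this
    linarith
  have hmono : Monotone n := fun i j hij => by
    by_contra! hlt
    have h1 := hf.antitone hij
    rw [hlam, hlam] at h1
    exact absurd (multiplier_lt τ hα (hn j) hlt) (not_lt.2 h1)
  have hle : ∀ m, (Finset.univ.filter fun j => n j = m).card ≤ 2 := fun m => by
    by_contra! h3
    obtain ⟨i, hi, j, hj, k, hk, hij, hik, hjk⟩ := Finset.two_lt_card.1 h3
    simp only [Finset.mem_filter, Finset.mem_univ, true_and] at hi hj hk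
    exact not_three_orthogonal (hne i) (hne j) (hne k) (horth i j hij (hi.trans hj.symm))
      (horth i k hik (hi.trans hk.symm)) (horth j k hjk (hj.trans hk.symm))
  have hge : ∀ (m : ℕ) (j : Fin J), m ≠ 0 → m < n j →
      2 ≤ (Finset.univ.filter fun j => n j = m).card := fun m j hm hmj => by
    by_contra! hlt
    have hone := Finset.card_le_one.1 (Nat.le_of_lt_succ hlt)
    simp only [Finset.mem_filter, Finset.mem_univ, true_and] at hone
    -- If at most one eigenfunction has frequency $m$, some direction of that plane is orthogonal to
    -- all the $f_i$: the rotation by a right angle of the one present, or any vector if there is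
    -- none. Its eigenvalue exceeds $\lambda_j$, against maximality.
    obtain ⟨c, d, hcd, ho⟩ : ∃ c d : ℝ, (c ≠ 0 ∨ d ≠ 0) ∧
        ∀ i, n i = m → a i * c + b i * d = 0 := by
      by_cases hex : ∃ i, n i = m
      · obtain ⟨i, hi⟩ := hex
        refine ⟨-b i, a i, ?_, fun k hk => ?_⟩
        · by_contra! h0
          exact hne i (by rw [h0.2, neg_eq_zero.1 h0.1]; ring)
        · rw [hone k hk i hi]; ring
      · exact ⟨1, 0, Or.inl one_ne_zero, fun i hi => absurd ⟨i, hi⟩ hex⟩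
    have := hf.first _ _ (isEigenpair_trig hV τ hα hm hcd) (fun i => by
      rw [innerV_trig hm (hfj i) (Filter.EventuallyEq.refl _ _)]
      by_cases him : n i = m
      · rw [if_pos him, ho i him, mul_zero]
      · rw [if_neg him]) j
    rw [hlam] at this
    exact absurd (multiplier_lt τ hα hm hmj) (not_lt.2 this)
  have hnj := eq_half_add_one_of_card_fiber hmono hn hle hge
  refine ⟨a, b, fun j => hnj j ▸ hfj j, fun j => hnj j ▸ hlam j, hne, hnorm,
    fun i j hij h2 => horth i j hij ?_⟩
  rw [hnj, hnj, h2]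

/-- The involution of `Fin J`, `J` even, exchanging `2 k` and `2 k + 1`. -/
theorem exists_pairing {J : ℕ} (hJ : Even J) :
    ∃ s : Equiv.Perm (Fin J), ∀ j, s j ≠ j ∧ (s j : ℕ) / 2 = j / 2 := by
  have hlt : ∀ j : Fin J, (if (j : ℕ) % 2 = 0 then (j : ℕ) + 1 else j - 1) < J := fun j => by
    obtain ⟨k, rfl⟩ := hJ
    have := j.2
    split_ifs <;> omega
  have hinv : Function.Involutive fun j : Fin J => (⟨_, hlt j⟩ : Fin J) := fun j => by
    apply Fin.ext
    dsimp only
    split_ifs <;> omega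
  refine ⟨hinv.toPerm, fun j => ⟨fun h => ?_, ?_⟩⟩
  · have := congrArg Fin.val h
    simp only [Function.Involutive.coe_toPerm] at this
    split_ifs at this <;> omega
  · simp only [Function.Involutive.coe_toPerm]
    split_ifs <;> omega

/-- Reindexing by the pairing and adding counts every pair twice, hence the factor $1/2$. -/
theorem sum_eq_const_of_pairing {J : ℕ} (hJ : Even J) {X : Type*} (F : Fin J → X → ℝ)
    (w : Fin J → ℝ)
    (h : ∀ (i j : Fin J) (x : X), i ≠ j → (i : ℕ) / 2 = j / 2 → F i x + F j x = w j) (x : X) :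
    ∑ j, F j x = (∑ j, w j) / 2 := by
  obtain ⟨s, hs⟩ := exists_pairing hJ
  have h1 : ∑ j, F (s j) x = ∑ j, F j x := Equiv.sum_comp s fun j => F j x
  have h2 : ∑ j, (F (s j) x + F j x) = ∑ j, w j :=
    Finset.sum_congr rfl fun j _ => h _ _ _ (hs j).1 (hs j).2
  rw [Finset.sum_add_distrib, h1] at h2
  linarith

/-! ### The Poisson equation -/

theorem partitionFn_pos {V U : Torus → ℝ} (hV : Continuous V) (hU : Continuous U) :
    0 < partitionFn V U :=
  integral_exp_pos (by fun_prop : Continuous fun x => Real.exp (-V x - U x)).torus_integrable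

theorem integral_gibbs (V U F : Torus → ℝ) :
    ∫ x, F x ∂(gibbs V U) = (partitionFn V U)⁻¹ * ∫ x, Real.exp (-V x - U x) * F x := by
  rw [gibbs, integral_tilted, ← integral_const_mul]
  congr 1
  ext x
  rw [smul_eq_mul, partitionFn]
  ring

instance isFiniteMeasure_gibbs (V U : Torus → ℝ) : IsFiniteMeasure (gibbs V U) := by
  unfold gibbs
  infer_instance

theorem memLp_of_memLp_gibbs {V U F : Torus → ℝ} (hV : Continuous V) (hU : Continuous U)
    (hF : MemLp F 2 (gibbs V U)) (hm : AEStronglyMeasurable F volume) : MemLp F 2 := by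
  have hi : Integrable fun x => Real.exp (-V x - U x) :=
    (by fun_prop : Continuous fun x => Real.exp (-V x - U x)).torus_integrable
  rw [memLp_two_iff_integrable_sq hF.aestronglyMeasurable, gibbs, integrable_tilted_iff hi] at hF
  rw [memLp_two_iff_integrable_sq hm]
  have hc : Continuous fun x => Real.exp (V x + U x) := by fun_prop
  obtain ⟨C, hC⟩ := isCompact_univ.exists_bound_of_continuousOn hc.continuousOn
  refine (hF.bdd_mul (c := C) hc.aestronglyMeasurable
    (Filter.Eventually.of_forall fun x => hC x trivial)).congr
    (Filter.Eventually.of_forall fun x => ?_)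
  simp only [smul_eq_mul]
  rw [← mul_assoc, ← Real.exp_add]
  have : V x + U x + (-V x - U x) = 0 := by ring
  rw [this, Real.exp_zero, one_mul]

theorem HasTorusDeriv.hasWeakDeriv {φ g : Torus → ℝ} (h : HasTorusDeriv φ g) :
    HasWeakDeriv φ g :=
  ⟨h.continuous.torus_integrable, h.continuous_deriv.torus_integrable,
    fun _ hψ => h.integral_mul hψ.hasTorusDeriv⟩

theorem HasTorusDeriv.integral_deriv {φ g : Torus → ℝ} (h : HasTorusDeriv φ g) :
    ∫ x, g x = 0 := by
  have h1 := (isSmooth_const 1).hasTorusDeriv.integral_mul h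
  have h2 : torusDeriv (fun _ => (1 : ℝ)) = fun _ => 0 := by
    ext x; simp [torusDeriv]
  simpa [h2] using h1

/-- The flux $e^{-V-U}\phi'=G+c$ has derivative $-h$, so the weak equation is one integration by
parts. -/
theorem isPoissonSolution_of_hasTorusDeriv {V U f h G φ : Torus → ℝ} {c : ℝ}
    (hf : f =ᵐ[volume] fun x => Real.exp (V x) * h x)
    (hG : HasTorusDeriv G fun x => -h x)
    (hφ : HasTorusDeriv φ fun x => Real.exp (V x + U x) * (G x + c))
    (h0 : ∫ x, φ x ∂(gibbs V U) = 0) :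
    IsPoissonSolution V U f φ fun x => Real.exp (V x + U x) * (G x + c) where
  memLp := hφ.continuous.torus_memLp _ _
  mean_zero := h0
  weakDeriv := hφ.hasWeakDeriv
  memLp_deriv := hφ.continuous_deriv.torus_memLp _ _
  weak_eq ψ hψ := by
    -- The observable is centred because $h=-G'$ integrates to zero.
    have hmean : ∫ y, f y ∂(gibbs V 0) = 0 := by
      have h1 := hG.integral_deriv
      rw [integral_neg, neg_eq_zero] at h1
      rw [integral_gibbs, ← mul_zero (partitionFn V 0)⁻¹, ← h1]
      congr 1
      refine integral_congr_ae ?_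
      filter_upwards [hf] with x hx
      rw [hx, ← mul_assoc, ← Real.exp_add]
      simp
    have h1 := (hG.add_const c).integral_mul hψ.hasTorusDeriv
    rw [hmean, integral_gibbs, integral_gibbs]
    congr 1
    have e1 : ∀ x, Real.exp (-V x - U x) *
        (Real.exp (V x + U x) * (G x + c) * torusDeriv ψ x) = (G x + c) * torusDeriv ψ x := by
      intro x
      rw [mul_assoc, ← mul_assoc, ← Real.exp_add]
      have : -V x - U x + (V x + U x) = 0 := by ring
      rw [this, Real.exp_zero, one_mul]
    simp_rw [e1]
    rw [h1, ← integral_neg]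
    refine integral_congr_ae ?_
    filter_upwards [hf] with x hx
    rw [hx, sub_zero]
    have : Real.exp (-V x - U x) * (Real.exp (V x) * Real.exp (U x)) = 1 := by
      rw [← Real.exp_add, ← Real.exp_add, ← Real.exp_zero]
      congr 1; ring
    linear_combination (-(h x * ψ x)) * this

/-- The constant of integration in the derivative of the Poisson solution. -/
noncomputable def fluxConst (V U G : Torus → ℝ) : ℝ :=
  -(∫ x, Real.exp (V x + U x) * G x) / ∫ x, Real.exp (V x + U x)

theorem integral_exp_add_pos {V U : Torus → ℝ} (hV : Continuous V) (hU : Continuous U) :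
    0 < ∫ x, Real.exp (V x + U x) :=
  integral_exp_pos (by fun_prop : Continuous fun x => Real.exp (V x + U x)).torus_integrable

theorem exists_isPoissonSolution {V U f h G : Torus → ℝ} (hV : Continuous V)
    (hU : Continuous U) (hf : f =ᵐ[volume] fun x => Real.exp (V x) * h x)
    (hG : HasTorusDeriv G fun x => -h x) :
    ∃ φ, IsPoissonSolution V U f φ fun x => Real.exp (V x + U x) * (G x + fluxConst V U G) := by
  have hGc := hG.continuous
  have hE : Continuous fun x => Real.exp (V x + U x) := by fun_prop
  have hmean : ∫ x, Real.exp (V x + U x) * (G x + fluxConst V U G) = 0 := by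
    simp_rw [mul_add]
    rw [integral_add (Continuous.torus_integrable (by fun_prop))
      (Continuous.torus_integrable (by fun_prop)), integral_mul_const, fluxConst,
      mul_div_cancel₀ _ (integral_exp_add_pos hV hU).ne', add_neg_cancel]
  obtain ⟨φ, hφ⟩ := exists_hasTorusDeriv (hE.mul (hGc.add continuous_const)) hmean
  refine ⟨fun x => φ x + -(∫ x, φ x ∂(gibbs V U)),
    isPoissonSolution_of_hasTorusDeriv hf hG (hφ.add_const _) ?_⟩
  have : IsProbabilityMeasure (gibbs V U) := isProbabilityMeasure_tilted
    (by fun_prop : Continuous fun x => Real.exp (-V x - U x)).torus_integrable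
  rw [integral_add (memLp_one_iff_integrable.1 (hφ.continuous.torus_memLp 1 _))
    (integrable_const _)]
  simp

theorem IsPoissonSolution.memLp_volume {V U f φ g : Torus → ℝ} (hV : Continuous V)
    (hU : Continuous U) (h : IsPoissonSolution V U f φ g) : MemLp φ 2 ∧ MemLp g 2 :=
  ⟨memLp_of_memLp_gibbs hV hU h.memLp h.weakDeriv.1.aestronglyMeasurable,
    memLp_of_memLp_gibbs hV hU h.memLp_deriv h.weakDeriv.2.1.aestronglyMeasurable⟩

theorem MemLp.mul_continuous {F w : Torus → ℝ} (hF : MemLp F 2) (hw : Continuous w) :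
    MemLp (fun x => w x * F x) 2 :=
  hF.mul (hw.torus_memLp ⊤ _)

/-- The difference of the fluxes is weakly constant, so $g'-g=c\,e^{V+U}$. Weak derivatives have
mean zero (test with $1$), which forces $c=0$. Then $\phi'-\phi$ is constant, and the normalization
removes it. -/
theorem IsPoissonSolution.unique {V U f φ g φ' g' : Torus → ℝ} (hV : Continuous V)
    (hU : Continuous U) (h : IsPoissonSolution V U f φ g) (h' : IsPoissonSolution V U f φ' g') :
    φ' =ᵐ[volume] φ ∧ g' =ᵐ[volume] g := by
  obtain ⟨hφ, hg⟩ := h.memLp_volume hV hU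
  obtain ⟨hφ', hg'⟩ := h'.memLp_volume hV hU
  have hE : Continuous fun x => Real.exp (-V x - U x) := by fun_prop
  have hE' : Continuous fun x => Real.exp (V x + U x) := by fun_prop
  have hmul : ∀ {F ψ : Torus → ℝ}, MemLp F 2 → Continuous ψ → Integrable fun x => F x * ψ x :=
    fun hF hψ => hF.integrable_mul (hψ.torus_memLp 2 _)
  have hgg : g' =ᵐ[volume] g := by
    obtain ⟨c, hc⟩ := ae_eq_const_of_integral_mul_torusDeriv
      (MemLp.mul_continuous (hg'.sub hg) hE) fun ψ hψ => by
        have hψ' := hψ.hasTorusDeriv.continuous_deriv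
        have e := (h'.weak_eq ψ hψ).trans (h.weak_eq ψ hψ).symm
        rw [integral_gibbs, integral_gibbs] at e
        have e := mul_left_cancel₀ (inv_ne_zero (partitionFn_pos hV hU).ne') e
        rw [← sub_eq_zero, ← integral_sub] at e
        · rw [← e]
          congr 1
          ext x
          simp only [Pi.sub_apply]
          ring
        · exact (hmul hg' (hE.mul hψ')).congr (Filter.Eventually.of_forall fun x => by
            simp only [Pi.mul_apply]; ring)
        · exact (hmul hg (hE.mul hψ')).congr (Filter.Eventually.of_forall fun x => by
            simp only [Pi.mul_apply]; ring)
    have hd : ∀ᵐ x, g' x - g x = c * Real.exp (V x + U x) := by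
      filter_upwards [hc] with x hx
      rw [← hx, Pi.sub_apply, mul_right_comm, ← Real.exp_add]
      have : -V x - U x + (V x + U x) = 0 := by ring
      rw [this, Real.exp_zero, one_mul]
    have h2 : torusDeriv (fun _ => (1 : ℝ)) = fun _ => 0 := by
      ext x; simp [torusDeriv]
    have hg0 : ∫ x, g x = 0 := by
      simpa [h2] using h.weakDeriv.2.2 _ (isSmooth_const 1)
    have hg0' : ∫ x, g' x = 0 := by
      simpa [h2] using h'.weakDeriv.2.2 _ (isSmooth_const 1)
    have hint := integral_congr_ae hd
    rw [integral_sub h'.weakDeriv.2.1 h.weakDeriv.2.1, hg0, hg0', integral_const_mul, sub_zero]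
      at hint
    have hc0 : c = 0 :=
      (mul_eq_zero.1 hint.symm).resolve_right (integral_exp_add_pos hV hU).ne'
    filter_upwards [hd] with x hx
    rw [hc0, zero_mul] at hx
    linarith
  refine ⟨?_, hgg⟩
  obtain ⟨c, hc⟩ := ae_eq_const_of_integral_mul_torusDeriv (hφ'.sub hφ) fun ψ hψ => by
    have hψ' := hψ.hasTorusDeriv.continuous_deriv
    simp only [Pi.sub_apply, sub_mul]
    rw [integral_sub (hmul hφ' hψ') (hmul hφ hψ'), h'.weakDeriv.2.2 ψ hψ, h.weakDeriv.2.2 ψ hψ,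
      integral_congr_ae (hgg.mono fun x hx => by simp only [hx] :
        (fun x => g' x * ψ x) =ᵐ[volume] fun x => g x * ψ x), sub_self]
  have hac : gibbs V U ≪ volume := tilted_absolutelyContinuous _ _
  have : IsProbabilityMeasure (gibbs V U) := isProbabilityMeasure_tilted hE.torus_integrable
  have hint := integral_congr_ae (hac.ae_le hc)
  simp only [Pi.sub_apply] at hint
  rw [integral_sub (h'.memLp.integrable (by norm_num)) (h.memLp.integrable (by norm_num)),
    h.mean_zero, h'.mean_zero] at hint
  have hc0 : c = 0 := by simpa using hint.symm
  filter_upwards [hc] with x hx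
  rw [hc0, Pi.sub_apply] at hx
  linarith

theorem asymVar_eq {V U f h G : Torus → ℝ} (hV : Continuous V)
    (hU : Continuous U) (hf : f =ᵐ[volume] fun x => Real.exp (V x) * h x)
    (hG : HasTorusDeriv G fun x => -h x) :
    asymVar V f U = 2 * partitionFn V U / partitionFn V 0 ^ 2 *
      ((∫ x, Real.exp (V x + U x) * (G x * G x)) -
        (∫ x, Real.exp (V x + U x) * G x) * (∫ x, Real.exp (V x + U x) * G x) /
          ∫ x, Real.exp (V x + U x)) := by
  obtain ⟨φ, hφ⟩ := exists_isPoissonSolution hV hU hf hG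
  have hex : ∃ p : (Torus → ℝ) × (Torus → ℝ), IsPoissonSolution V U f p.1 p.2 := ⟨(φ, _), hφ⟩
  -- `asymVar` uses an arbitrarily chosen solution; uniqueness identifies its derivative with the
  -- explicit one.
  have hg := (hφ.unique hV hU hex.choose_spec).2
  have hGc := hG.continuous
  have hE : Continuous fun x => Real.exp (V x + U x) := by fun_prop
  have hA := (integral_exp_add_pos hV hU).ne'
  have hZ := (partitionFn_pos hV hU).ne'
  rw [asymVar, dif_pos hex, integral_gibbs]
  have e : ∫ x, Real.exp (-V x - U x) * hex.choose.2 x ^ 2 =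
      ∫ x, (Real.exp (V x + U x) * (G x * G x) +
        2 * fluxConst V U G * (Real.exp (V x + U x) * G x)) +
        fluxConst V U G ^ 2 * Real.exp (V x + U x) := by
    refine integral_congr_ae ?_
    filter_upwards [hg] with x hx
    rw [hx]
    have : Real.exp (-V x - U x) * Real.exp (V x + U x) = 1 := by
      rw [← Real.exp_add, ← Real.exp_zero]
      congr 1; ring
    linear_combination (Real.exp (V x + U x) * (G x + fluxConst V U G) ^ 2) * this
  rw [e, integral_add, integral_add, integral_const_mul, integral_const_mul]
  · simp only [fluxConst]
    field_simp
    ring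
  all_goals exact Continuous.torus_integrable (by fun_prop)

/-! ### The Gaussian average -/

instance isProbabilityMeasure_stdGaussian (J : ℕ) : IsProbabilityMeasure (stdGaussian J) := by
  unfold stdGaussian
  infer_instance

theorem memLp_eval_stdGaussian {J : ℕ} (i : Fin J) :
    MemLp (fun u : Fin J → ℝ => u i) 2 (stdGaussian J) :=
  (memLp_id_gaussianReal' 2 (by norm_num)).comp_measurePreserving
    (measurePreserving_eval (fun _ : Fin J => gaussianReal 0 1) i)

theorem integrable_mul_stdGaussian {J : ℕ} (i j : Fin J) :
    Integrable (fun u : Fin J → ℝ => u i * u j) (stdGaussian J) :=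
  (memLp_eval_stdGaussian i).integrable_mul (memLp_eval_stdGaussian j)

theorem integral_comp_eval_stdGaussian {J : ℕ} (i : Fin J) {F : ℝ → ℝ} (hF : Measurable F) :
    ∫ u, F (u i) ∂(stdGaussian J) = ∫ x, F x ∂(gaussianReal 0 1) := by
  have hp := measurePreserving_eval (fun _ : Fin J => gaussianReal 0 1) i
  rw [← hp.map_eq, integral_map hp.measurable.aemeasurable hF.aestronglyMeasurable]
  rfl

theorem integral_mul_stdGaussian {J : ℕ} (i j : Fin J) :
    ∫ u, u i * u j ∂(stdGaussian J) = if i = j then 1 else 0 := by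
  have h0 : ∀ i : Fin J, ∫ u, u i ∂(stdGaussian J) = 0 := fun i => by
    rw [integral_comp_eval_stdGaussian i measurable_id']
    exact integral_id_gaussianReal
  by_cases hij : i = j
  · subst hij
    rw [if_pos rfl,
      integral_comp_eval_stdGaussian i (F := fun x => x * x) (by fun_prop)]
    have h := variance_eq_integral (μ := gaussianReal 0 1) measurable_id'.aemeasurable
    rw [variance_fun_id_gaussianReal, integral_id_gaussianReal] at h
    simp only [NNReal.coe_one, sub_zero] at h
    rw [h]
    congr 1
    ext x
    simp [sq]
  · have hind : iIndepFun (fun (i : Fin J) (u : Fin J → ℝ) => u i) (stdGaussian J) :=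
      iIndepFun_pi (X := fun _ x => x) fun _ => measurable_id'.aemeasurable
    have := (hind.indepFun hij).integral_fun_mul_eq_mul_integral
      (memLp_eval_stdGaussian i).aestronglyMeasurable
      (memLp_eval_stdGaussian j).aestronglyMeasurable
    rw [if_neg hij, this, h0, zero_mul]

theorem integral_quadratic_stdGaussian {J : ℕ} (q : Fin J → Fin J → ℝ) :
    Integrable (fun u : Fin J → ℝ => ∑ i, ∑ j, u i * u j * q i j) (stdGaussian J) ∧
      ∫ u, ∑ i, ∑ j, u i * u j * q i j ∂(stdGaussian J) = ∑ i, q i i := by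
  have hi : ∀ i j, Integrable (fun u : Fin J → ℝ => u i * u j * q i j) (stdGaussian J) :=
    fun i j => (integrable_mul_stdGaussian i j).mul_const _
  have hs : ∀ i, Integrable (fun u : Fin J → ℝ => ∑ j, u i * u j * q i j) (stdGaussian J) :=
    fun i => integrable_finsetSum _ fun j _ => hi i j
  refine ⟨integrable_finsetSum _ fun i _ => hs i, ?_⟩
  rw [integral_finsetSum _ fun i _ => hs i]
  refine Finset.sum_congr rfl fun i _ => ?_
  rw [integral_finsetSum _ fun j _ => hi i j]
  simp_rw [integral_mul_const, integral_mul_stdGaussian]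
  simp

/-! ### The averaged asymptotic variance -/

section Observable

variable {V U : Torus → ℝ} {J : ℕ} {f h G : Fin J → Torus → ℝ} {lam : Fin J → ℝ}

theorem observable_ae_eq (hf : ∀ j, f j =ᵐ[volume] fun x => Real.exp (V x) * h j x)
    (u : Fin J → ℝ) :
    observable lam f u =ᵐ[volume]
      fun x => Real.exp (V x) * ∑ j, Real.sqrt (lam j) * u j * h j x := by
  filter_upwards [ae_all_iff.2 hf] with x hx
  rw [observable, Finset.mul_sum]
  refine Finset.sum_congr rfl fun j _ => ?_
  rw [hx j]
  ring

theorem hasTorusDeriv_observable (hG : ∀ j, HasTorusDeriv (G j) fun x => -h j x)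
    (u : Fin J → ℝ) :
    HasTorusDeriv (fun x => ∑ j, Real.sqrt (lam j) * u j * G j x)
      fun x => -∑ j, Real.sqrt (lam j) * u j * h j x := by
  have := HasTorusDeriv.sum Finset.univ fun j _ =>
    (hG j).const_mul (Real.sqrt (lam j) * u j)
  simpa only [mul_neg, Finset.sum_neg_distrib] using this

/-- The primitive $G$ depends linearly on $u$, so the closed form polarizes into a quadratic form in
$u$. This gives integrability and reduces the average to a trace. -/
theorem asymVar_observable (hV : Continuous V) (hU : Continuous U)
    (hf : ∀ j, f j =ᵐ[volume] fun x => Real.exp (V x) * h j x)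
    (hG : ∀ j, HasTorusDeriv (G j) fun x => -h j x) (u : Fin J → ℝ) :
    asymVar V (observable lam f u) U = ∑ i, ∑ j, u i * u j *
      (2 * partitionFn V U / partitionFn V 0 ^ 2 * (Real.sqrt (lam i) * Real.sqrt (lam j)) *
        ((∫ x, Real.exp (V x + U x) * (G i x * G j x)) -
          (∫ x, Real.exp (V x + U x) * G i x) * (∫ x, Real.exp (V x + U x) * G j x) /
            ∫ x, Real.exp (V x + U x))) := by
  have hGc := fun j => (hG j).continuous
  rw [asymVar_eq hV hU (observable_ae_eq hf u) (hasTorusDeriv_observable hG u)]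
  have e1 : ∫ x, Real.exp (V x + U x) * ∑ j, Real.sqrt (lam j) * u j * G j x =
      ∑ j, Real.sqrt (lam j) * u j * ∫ x, Real.exp (V x + U x) * G j x := by
    simp_rw [← integral_const_mul, Finset.mul_sum]
    rw [integral_finsetSum _ fun j _ => Continuous.torus_integrable (by fun_prop)]
    refine Finset.sum_congr rfl fun j _ => ?_
    congr 1
    ext x
    ring
  have e2 : ∫ x, Real.exp (V x + U x) * ((∑ i, Real.sqrt (lam i) * u i * G i x) *
        ∑ j, Real.sqrt (lam j) * u j * G j x) =
      ∑ i, ∑ j, Real.sqrt (lam i) * u i * (Real.sqrt (lam j) * u j) *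
        ∫ x, Real.exp (V x + U x) * (G i x * G j x) := by
    simp_rw [← integral_const_mul, Finset.sum_mul_sum, Finset.mul_sum]
    rw [integral_finsetSum _ fun i _ => Continuous.torus_integrable (by fun_prop)]
    refine Finset.sum_congr rfl fun i _ => ?_
    rw [integral_finsetSum _ fun j _ => Continuous.torus_integrable (by fun_prop)]
    refine Finset.sum_congr rfl fun j _ => ?_
    congr 1
    ext x
    ring
  rw [e1, e2, Finset.sum_mul_sum, Finset.sum_div, ← Finset.sum_sub_distrib, Finset.mul_sum]
  refine Finset.sum_congr rfl fun i _ => ?_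
  rw [Finset.sum_div, ← Finset.sum_sub_distrib, Finset.mul_sum]
  refine Finset.sum_congr rfl fun j _ => ?_
  ring

theorem integrable_asymVar_observable (hV : Continuous V) (hU : Continuous U)
    (hf : ∀ j, f j =ᵐ[volume] fun x => Real.exp (V x) * h j x)
    (hG : ∀ j, HasTorusDeriv (G j) fun x => -h j x) :
    Integrable (fun u => asymVar V (observable lam f u) U) (stdGaussian J) := by
  simp_rw [asymVar_observable hV hU hf hG]
  exact (integral_quadratic_stdGaussian _).1

/-- Constancy of $\sum_j\lambda_jG_j^2$ reduces the first term of the average to a multiple of $\int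
e^{V+U}$. -/
theorem avgAsymVar_eq (hV : Continuous V) (hU : Continuous U) (hlam : ∀ j, 0 ≤ lam j)
    (hf : ∀ j, f j =ᵐ[volume] fun x => Real.exp (V x) * h j x)
    (hG : ∀ j, HasTorusDeriv (G j) fun x => -h j x)
    {C : ℝ} (hC : ∀ x, ∑ j, lam j * G j x ^ 2 = C) :
    avgAsymVar V lam f U = 2 * partitionFn V U / partitionFn V 0 ^ 2 *
      ((C * ∫ x, Real.exp (V x + U x)) -
        (∑ j, lam j * (∫ x, Real.exp (V x + U x) * G j x) ^ 2) /
          ∫ x, Real.exp (V x + U x)) := by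
  have hGc := fun j => (hG j).continuous
  have e : C * ∫ x, Real.exp (V x + U x) =
      ∑ j, lam j * ∫ x, Real.exp (V x + U x) * (G j x * G j x) := by
    simp_rw [← integral_const_mul]
    rw [← integral_finsetSum _ fun i _ => Continuous.torus_integrable (by fun_prop)]
    congr 1
    ext x
    rw [← hC x, Finset.sum_mul]
    refine Finset.sum_congr rfl fun j _ => ?_
    ring
  unfold avgAsymVar
  simp_rw [asymVar_observable hV hU hf hG]
  rw [(integral_quadratic_stdGaussian _).2, e, Finset.sum_div, ← Finset.sum_sub_distrib,
    Finset.mul_sum]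
  refine Finset.sum_congr rfl fun j _ => ?_
  rw [Real.mul_self_sqrt (hlam j)]
  ring

/-! ### The critical point -/

theorem hasDerivAt_integral_exp_mul {δ F : Torus → ℝ} (hδ : Continuous δ) (hF : Continuous F) :
    HasDerivAt (fun ε : ℝ => ∫ x, Real.exp (ε * δ x) * F x) (∫ x, δ x * F x) 0 := by
  obtain ⟨M, hM⟩ := isCompact_univ.exists_bound_of_continuousOn hδ.continuousOn
  have hM0 : 0 ≤ M := (norm_nonneg _).trans (hM 0 trivial)
  -- For $|\varepsilon|<1$ and $|\delta|\le M$ the differentiated integrand is dominated by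
  -- $Me^M|F|$.
  have h := (hasDerivAt_integral_of_dominated_loc_of_deriv_le (μ := (volume : Measure Torus))
    (F := fun ε x => Real.exp (ε * δ x) * F x)
    (F' := fun ε x => δ x * Real.exp (ε * δ x) * F x)
    (x₀ := (0 : ℝ)) (s := Metric.ball 0 1) (bound := fun x => M * Real.exp M * ‖F x‖)
    (Metric.ball_mem_nhds _ one_pos)
    (Filter.Eventually.of_forall fun ε => Continuous.aestronglyMeasurable (by fun_prop))
    (Continuous.torus_integrable (by fun_prop))
    (Continuous.aestronglyMeasurable (by fun_prop))
    (Filter.Eventually.of_forall fun x ε hε => ?_)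
    (Continuous.torus_integrable (by fun_prop))
    (Filter.Eventually.of_forall fun x ε _ => ?_)).2
  · simpa using h
  · have h1 := hM x trivial
    rw [mem_ball_zero_iff] at hε
    rw [norm_mul, norm_mul, Real.norm_of_nonneg (Real.exp_pos _).le]
    gcongr
    calc ε * δ x ≤ ‖ε * δ x‖ := Real.le_norm_self _
      _ = ‖ε‖ * ‖δ x‖ := norm_mul _ _
      _ ≤ 1 * M := by gcongr
      _ = M := one_mul M
  · have := (((hasDerivAt_id' ε).mul_const (δ x)).exp).mul_const (F x)
    refine this.congr_deriv ?_
    ring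

theorem isCriticalPoint_neg (hV : Continuous V) (hlam : ∀ j, 0 ≤ lam j)
    (hf : ∀ j, f j =ᵐ[volume] fun x => Real.exp (V x) * h j x)
    (hG : ∀ j, HasTorusDeriv (G j) fun x => -h j x)
    {C : ℝ} (hC : ∀ x, ∑ j, lam j * G j x ^ 2 = C) (hG0 : ∀ j, ∫ x, G j x = 0) :
    IsCriticalPoint (avgAsymVar V lam f) fun x => -V x := by
  intro δ hδ
  have hδc := hδ.continuous
  set A : ℝ → ℝ := fun ε => ∫ x, Real.exp (ε * δ x) with hAdef
  set B : Fin J → ℝ → ℝ := fun j ε => ∫ x, Real.exp (ε * δ x) * G j x with hBdef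
  have hA : HasDerivAt A (∫ x, δ x) 0 := by
    simpa using hasDerivAt_integral_exp_mul hδc continuous_const (F := fun _ => 1)
  have hB : ∀ j, HasDerivAt (B j) (∫ x, δ x * G j x) 0 := fun j =>
    hasDerivAt_integral_exp_mul hδc (hG j).continuous
  have hB0 : ∀ j, B j 0 = 0 := fun j => by simp [hBdef, hG0 j]
  have hA0 : A 0 ≠ 0 :=
    (integral_exp_pos (by fun_prop : Continuous fun x => Real.exp (0 * δ x)).torus_integrable).ne'
  -- The weights $e^{V+U}$ and $e^{-V-U}$ become $e^{\varepsilon\delta}$ and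
  -- $e^{-\varepsilon\delta}$, so the partition function is $A(-\varepsilon)$.
  have heq : (fun ε : ℝ => avgAsymVar V lam f fun x => -V x + ε * δ x) = fun ε =>
      2 * A (-ε) / partitionFn V 0 ^ 2 * (C * A ε - (∑ j, lam j * B j ε ^ 2) / A ε) := by
    ext ε
    rw [avgAsymVar_eq hV (by fun_prop) hlam hf hG hC]
    have e1 : ∀ x, V x + (-V x + ε * δ x) = ε * δ x := fun x => by ring
    have e2 : partitionFn V (fun x => -V x + ε * δ x) = A (-ε) := by
      simp only [partitionFn, hAdef]
      congr 1
      ext x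
      congr 1
      ring
    simp only [e1, e2, hAdef, hBdef]
  rw [heq]
  have hAneg : HasDerivAt (fun ε => A (-ε)) (-∫ x, δ x) 0 := by
    have hA' : HasDerivAt A (∫ x, δ x) (-0) := by rwa [neg_zero]
    exact (hA'.comp (0 : ℝ) (hasDerivAt_neg 0)).congr_deriv (mul_neg_one _)
  -- Each $B_j$ vanishes at $0$, so its square has no first-order term.
  have hS : HasDerivAt (fun ε => ∑ j, lam j * B j ε ^ 2) 0 0 := by
    have := HasDerivAt.fun_sum (u := Finset.univ) fun j _ => ((hB j).pow 2).const_mul (lam j)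
    simpa [hB0] using this
  have hS0 : ∑ j, lam j * B j 0 ^ 2 = 0 := by simp [hB0]
  have := ((hAneg.const_mul 2).div_const (partitionFn V 0 ^ 2)).mul
    ((hA.const_mul C).sub (hS.div hA hA0))
  refine this.congr_deriv ?_
  simp only [Pi.sub_apply, Pi.div_apply, hS0, neg_zero]
  ring

end Observable

/-! ### Explicit Poisson solutions at $U=-V$ -/

theorem hasTorusDeriv_flux {m : ℕ} (hm : m ≠ 0) (a b : ℝ) :
    HasTorusDeriv (fun x => (m : ℝ)⁻¹ * (a * cosMode m x - b * sinMode m x))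
      fun x => -trig m a b x := by
  have h := (((hasTorusDeriv_cosMode m).const_mul a).add
    ((hasTorusDeriv_sinMode m).const_mul (-b))).const_mul (m : ℝ)⁻¹
  have hm' : (m : ℝ) ≠ 0 := by exact_mod_cast hm
  convert h using 2 with x x
  · ring
  · simp only [trig]
    field_simp
    ring

theorem hasTorusDeriv_inv_sq_mul_trig {m : ℕ} (hm : m ≠ 0) (a b : ℝ) :
    HasTorusDeriv (fun x => ((m : ℝ) ^ 2)⁻¹ * trig m a b x)
      fun x => (m : ℝ)⁻¹ * (a * cosMode m x - b * sinMode m x) := by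
  have h := (((hasTorusDeriv_sinMode m).const_mul a).add
    ((hasTorusDeriv_cosMode m).const_mul b)).const_mul ((m : ℝ) ^ 2)⁻¹
  have hm' : (m : ℝ) ≠ 0 := by exact_mod_cast hm
  convert h using 2 with x x
  · rfl
  · field_simp
    ring

/-- At $U=-V$ the weight is $1$ and the flux already has mean zero, so the constant of integration
is $0$. -/
theorem isPoissonSolution_trig {V f : Torus → ℝ} {m : ℕ} (hm : m ≠ 0) {a b : ℝ}
    (hf : f =ᵐ[volume] fun x => Real.exp (V x) * trig m a b x) :
    IsPoissonSolution V (fun x => -V x) f (fun x => ((m : ℝ) ^ 2)⁻¹ * trig m a b x)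
      fun x => (m : ℝ)⁻¹ * (a * cosMode m x - b * sinMode m x) := by
  have := isPoissonSolution_of_hasTorusDeriv (U := fun x => -V x) (c := 0) hf
    (hasTorusDeriv_flux hm a b) (by simpa using hasTorusDeriv_inv_sq_mul_trig hm a b)
    (by rw [integral_gibbs]; simp [integral_const_mul, integral_trig hm])
  simpa using this

end BiasedLangevin

open BiasedLangevin MeasureTheory in
theorem mainTheorem10 (V : Torus → ℝ) (hV : IsSmooth V) (τ α : ℝ) (hα : 0 < α)
    (J : ℕ) (hJ : Even J) (hJ0 : 0 < J) (f : Fin J → Torus → ℝ) (lam : Fin J → ℝ)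
    (hf : IsFirstEigenpairs V τ α f lam) :
    -- the averaged asymptotic variance is well defined at every smooth biasing potential
    (∀ U : Torus → ℝ, IsSmooth U →
      (∀ u : Fin J → ℝ, ∃ φ g : Torus → ℝ, IsPoissonSolution V U (observable lam f u) φ g ∧
        ∀ φ' g' : Torus → ℝ, IsPoissonSolution V U (observable lam f u) φ' g' →
          φ' =ᵐ[volume] φ ∧ g' =ᵐ[volume] g) ∧
      Integrable (fun u => asymVar V (observable lam f u) U) (stdGaussian J)) ∧
    -- `U = -V` is a critical point
    IsCriticalPoint (avgAsymVar V lam f) (fun x => -V x) ∧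
    -- explicit Poisson solutions at `U = -V`
    (∃ a b : Fin J → ℝ,
      (∀ j, f j =ᵐ[volume] fun x => Real.exp (V x) *
        (a j * sinMode (j / 2 + 1) x + b j * cosMode (j / 2 + 1) x)) ∧
      (∀ j, IsPoissonSolution V (fun x => -V x) (f j)
        (fun x => (((j / 2 + 1 : ℕ) : ℝ) ^ 2)⁻¹ *
          (a j * sinMode (j / 2 + 1) x + b j * cosMode (j / 2 + 1) x))
        (fun x => ((j / 2 + 1 : ℕ) : ℝ)⁻¹ *
          (a j * cosMode (j / 2 + 1) x - b j * sinMode (j / 2 + 1) x))) ∧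
      ∃ C : ℝ, ∀ x : Torus, ∑ j, lam j * (((j / 2 + 1 : ℕ) : ℝ)⁻¹ *
          (a j * cosMode (j / 2 + 1) x - b j * sinMode (j / 2 + 1) x)) ^ 2 = C) := by
  have hVc := hV.continuous
  obtain ⟨a, b, hfj, hlam, hne, hnorm, horth⟩ := hf.exists_trig hVc hα
  have hlam0 : ∀ j, 0 ≤ lam j := fun j => hlam j ▸ multiplier_nonneg _ _ _
  -- Indices start at $0$ here, so $\lceil j/2\rceil$ becomes `j / 2 + 1`. The same functions serve
  -- as the $G_j$ and as the derivatives $\phi_j'$, so one constancy statement settles both claims.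
  have hG := fun j : Fin J => hasTorusDeriv_flux (Nat.succ_ne_zero (j / 2)) (a j) (b j)
  have hG0 := fun j : Fin J =>
    (hasTorusDeriv_inv_sq_mul_trig (Nat.succ_ne_zero (j / 2)) (a j) (b j)).integral_deriv
  have hC := sum_eq_const_of_pairing hJ
    (fun j x => lam j * (((j / 2 + 1 : ℕ) : ℝ)⁻¹ *
      (a j * cosMode (j / 2 + 1) x - b j * sinMode (j / 2 + 1) x)) ^ 2)
    (fun j => lam j * (((j / 2 + 1 : ℕ) : ℝ)⁻¹) ^ 2 * (a j ^ 2 + b j ^ 2))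
    (fun i j x hij h2 => by
      -- Paired indices share frequency and eigenvalue, so the two squares add up to a multiple of
      -- $\sin^2+\cos^2$.
      have h := sq_add_sq_of_orthogonal (hne j) (hnorm i j) rfl (horth i j hij h2)
        (cosMode (j / 2 + 1) x) (sinMode (j / 2 + 1) x)
      rw [sinMode_sq_add_cosMode_sq] at h
      simp only [hlam, h2]
      linear_combination (multiplier τ α ((j / 2 + 1 : ℕ) : ℤ) *
        (((j / 2 + 1 : ℕ) : ℝ)⁻¹) ^ 2) * h)
  refine ⟨fun U hU => ⟨fun u => ?_, integrable_asymVar_observable hVc hU.continuous hfj hG⟩,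
    isCriticalPoint_neg hVc hlam0 hfj hG hC hG0, a, b, hfj,
    fun j => isPoissonSolution_trig (Nat.succ_ne_zero (j / 2)) (hfj j), _, hC⟩
  obtain ⟨φ, hφ⟩ := exists_isPoissonSolution hVc hU.continuous (observable_ae_eq hfj u)
    (hasTorusDeriv_observable hG u)
  exact ⟨φ, _, hφ, fun φ' g' h' => hφ.unique hVc hU.continuous h'⟩
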